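/- **Conventions.** For $n\ge 1$, $NC(n)$ is the set of non-crossing partitions of $[n]=\{1,\dots,n\}$. For $t,s\ge 1$ let $\gamma_{t,s}=(1,\dots,t)(t+1,\dots,t+s)\in S_{t+s}$, and let $S_{NC}(t,s)$ be the set of annular non-crossing permutations, i.e. of all $\sigma\in S_{t+s}$ such that the subgroup $\langle\sigma,\gamma_{t,s}\rangle$ acts transitively on $[t+s]$ and $|\sigma|+|\sigma^{-1}\gamma_{t,s}|=t+s$, where $|\cdot|$ is the number of cycles, fixed points included. For a sequence $(u_n)_{n\ge1}$ put $u_\pi=\prod_{V\in\pi}u_{|V|}$ (product over the blocks of a partition) and $u_\sigma=\prod_{c\in\sigma}u_{|c|}$ (product over the cycles of a permutation, fixed points included). Let $\mu$ be a probability measure on $\mathbb R$ with finite moments $m_n(\mu)=\int x^n\,d\mu$ of all orders. Its free cumulants $(r_n(\mu))_{n\ge1}$ are defined recursively by $m_n(\mu)=\sum_{\pi\in NC(n)}r_\pi(\mu)$, $n\ge1$. Let $p$ be a monic real polynomial of degree $d\ge1$ with only real roots $\lambda_1,\dots,\lambda_d$ (with multiplicity). Put $m_n(p)=\frac1d\sum_{i=1}^d\lambda_i^n$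 and write $p(x)=\sum_{k=0}^d(-1)^k\binom dk a_k\,x^{d-k}$. For $1\le n\le d$ the finite-free cumulants of $p$ are $$\kappa_n(p)=\frac{(-d)^{n-1}}{(n-1)!}\sum_{\pi\in P(n)}(-1)^{|\pi|-1}(|\pi|-1)!\prod_{V\in\pi}a_{|V|},$$ where $P(n)$ is the set of all partitions of $[n]$ and $|\pi|$ is the number of blocks of $\pi$. A sequence $\mathfrak p=(p_d)_{d\ge1}$ of monic real-rooted polynomials with $\deg p_d=d$ has *infinitesimal distribution* $(\mu,\mu')$, where $\mu$ is a probability measure on $\mathbb R$ with finite moments of all orders and $\mu':\mathbb R[x]\to\mathbb R$ is linear, if for every $n\ge0$, as $d\to\infty$, $$m_n(p_d)\to m_n(\mu)\qquad\text{and}\qquad d\,\bigl(m_n(p_d)-m_n(\mu)\bigr)\to\mu'(x^n)$$ (so $\mu'(1)=0$). **Lemma.** Let $\mathfrak p=(p_d)_{d\ge1}$ have infinitesimal distribution $(\mu,\mu')$. Then for each $n\ge1$ the cumulant fluctuation $\widehat r_n(\mathfrak p)=\lim_{d\to\infty}d\,(\kappa_n(p_d)-r_n(\mu))$ exists, i.e.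 $$\kappa_n(p_d)=r_n(\mu)+\tfrac1d\,\widehat r_n(\mathfrak p)+o(1/d)\qquad(d\to\infty),$$ and the formal power series $$G_\mu(z)=\sum_{n\ge0}m_n(\mu)z^{-n-1},\qquad G_{\mu'}(z)=\sum_{n\ge0}\mu'(x^n)z^{-n-1},\qquad \widehat R_{\mathfrak p}(z)=\sum_{n\ge1}\widehat r_n(\mathfrak p)z^{n-1},$$ $$H_\mu(z)=\sum_{n\ge2}h_n(\mu)z^{-n-1},\qquad h_n(\mu)=\frac n2\sum_{\substack{t+s=n\\ t,s\ge1}}\ \sum_{\sigma\in S_{NC}(t,s)}\frac{r_\sigma(\mu)}{ts},$$ satisfy, as formal power series in $z^{-1}$ with $'$ denoting $d/dz$ on $G_\mu$, $$G_{\mu'}=-(\widehat R_{\mathfrak p}\circ G_\mu)\cdot G_\mu'-H_\mu .$$ -/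

import Mathlib

open Filter Topology Asymptotics MeasureTheory

namespace FiniteFree

/-! ### Non-crossing partitions and free cumulants -/

/-- Set partitions of `[n]`; `π.parts` is the set of blocks (all of them non-empty). -/
abbrev SetPartition (n : ℕ) : Type := Finpartition (Finset.univ : Finset (Fin n))

/-- A partition is non-crossing if `a < b < c < d` with `a, c ∈ V` and `b, d ∈ W` forces
`V = W`. -/
def IsNonCrossing {n : ℕ} (π : SetPartition n) : Prop :=
  ∀ a b c d : Fin n, a < b → b < c → c < d →
    ∀ V ∈ π.parts, ∀ W ∈ π.parts, a ∈ V → c ∈ V → b ∈ W → d ∈ W → V = W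

open scoped Classical in
/-- The set `NC(n)` of non-crossing partitions of `[n]`. -/
noncomputable def NC (n : ℕ) : Finset (SetPartition n) :=
  Finset.univ.filter IsNonCrossing

/-- A partition of `[n]` other than the one-block partition has only blocks with fewer than `n`
elements. -/
theorem card_lt_of_parts_ne {n : ℕ} {π : SetPartition n}
    (h : π.parts ≠ {Finset.univ}) {V : Finset (Fin n)} (hV : V ∈ π.parts) : V.card < n := by
  by_contra hlt
  have hVu : V = Finset.univ := by
    apply Finset.eq_univ_of_card
    have := Finset.card_le_univ V
    simp only [Fintype.card_fin] at this ⊢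
    omega
  apply h
  ext W
  rw [Finset.mem_singleton]
  constructor
  · intro hW
    by_contra hne
    have hdis : Disjoint W V := π.disjoint hW hV (by rw [hVu]; exact hne)
    rw [hVu] at hdis
    exact π.ne_bot hW (Finset.disjoint_self_iff_empty W |>.mp (hdis.mono_right (Finset.subset_univ W)))
  · rintro rfl
    exact hVu ▸ hV

open scoped Classical in
/-- The free cumulants `r_n` of a moment sequence `m`, defined recursively by the moment-cumulant
formula `m_n = ∑_{π ∈ NC(n)} ∏_{V ∈ π} r_{|V|}`, in which `r_n` itself occurs only in the term of
the one-block partition. -/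
noncomputable def freeCumulantSeq (m : ℕ → ℝ) (n : ℕ) : ℝ :=
  m n - ∑ π ∈ ((NC n).filter fun π => π.parts ≠ {Finset.univ}).attach,
    ∏ V ∈ π.1.parts.attach, freeCumulantSeq m V.1.card
  termination_by n
  decreasing_by exact card_lt_of_parts_ne (Finset.mem_filter.mp π.2).2 V.2

/-- The moment-cumulant formula. -/
theorem moment_eq_sum_freeCumulantSeq (m : ℕ → ℝ) (n : ℕ) (hn : 1 ≤ n) :
    m n = ∑ π ∈ NC n, ∏ V ∈ π.parts, freeCumulantSeq m V.card := by
  classical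
  have hne : (Finset.univ : Finset (Fin n)) ≠ ⊥ := by
    intro h
    have h2 := congrArg Finset.card h
    simp at h2
    omega
  have hmem : Finpartition.indiscrete hne ∈ NC n := by
    simp only [NC, Finset.mem_filter, Finset.mem_univ, true_and, IsNonCrossing,
      Finpartition.indiscrete_parts, Finset.mem_singleton]
    rintro a b c d - - - V rfl W rfl - - - -
    rfl
  have hfil : (NC n).filter (fun π => ¬ π.parts ≠ {Finset.univ})
      = {Finpartition.indiscrete hne} := by
    ext π
    simp only [Finset.mem_filter, not_not, Finset.mem_singleton]
    constructor
    · rintro ⟨-, h⟩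
      exact Finpartition.ext (by simpa using h)
    · rintro rfl
      exact ⟨hmem, by simp⟩
  rw [← Finset.sum_filter_add_sum_filter_not (NC n) (fun π => π.parts ≠ {Finset.univ}), hfil,
    Finset.sum_singleton]
  simp only [Finpartition.indiscrete_parts, Finset.prod_singleton, Finset.card_univ,
    Fintype.card_fin]
  conv_rhs => rw [freeCumulantSeq]
  rw [Finset.sum_attach ((NC n).filter fun π => π.parts ≠ {Finset.univ})
    (fun π => ∏ V ∈ π.parts.attach, freeCumulantSeq m V.1.card)]
  simp only [fun π : SetPartition n =>
    Finset.prod_attach π.parts (fun V => freeCumulantSeq m V.card)]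
  ring

/-- The `n`-th moment `m_n(μ)`. -/
noncomputable def measMoment (μ : Measure ℝ) (n : ℕ) : ℝ := ∫ x, x ^ n ∂μ

/-- The `n`-th free cumulant `r_n(μ)` (`n ≥ 1`). -/
noncomputable def freeCumulant (μ : Measure ℝ) (n : ℕ) : ℝ :=
  freeCumulantSeq (measMoment μ) n

/-! ### Annular non-crossing permutations -/

/-- The permutation `γ_{t,s} = (1,…,t)(t+1,…,t+s)` of `[t+s]`. -/
def annularGamma (t s : ℕ) : Equiv.Perm (Fin (t + s)) :=
  finSumFinEquiv.permCongr (Equiv.Perm.sumCongr (finRotate t) (finRotate s))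

/-- The number of cycles of a permutation, fixed points included. -/
def numCycles {n : ℕ} (σ : Equiv.Perm (Fin n)) : ℕ := Multiset.card σ.partition.parts

/-- The product `u_σ` of `u_{|c|}` over all cycles `c` of `σ`, fixed points included. -/
def cycleProd (u : ℕ → ℝ) {n : ℕ} (σ : Equiv.Perm (Fin n)) : ℝ := (σ.partition.parts.map u).prod

/-- Non-crossing permutations of the `(t,s)`-annulus: `⟨σ, γ_{t,s}⟩` acts transitively on `[t+s]`
and `|σ| + |σ⁻¹ γ_{t,s}| = t + s`. -/
def IsAnnularNonCrossing (t s : ℕ) (σ : Equiv.Perm (Fin (t + s))) : Prop :=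
  MulAction.IsPretransitive
      (Subgroup.closure ({σ, annularGamma t s} : Set (Equiv.Perm (Fin (t + s))))) (Fin (t + s)) ∧
    numCycles σ + numCycles (σ⁻¹ * annularGamma t s) = t + s

open scoped Classical in
/-- The set `S_NC(t,s)`. -/
noncomputable def annularNC (t s : ℕ) : Finset (Equiv.Perm (Fin (t + s))) :=
  Finset.univ.filter (IsAnnularNonCrossing t s)

/-- `h_n(μ) = (n/2) ∑_{t+s=n, t,s≥1} ∑_{σ ∈ S_NC(t,s)} r_σ(μ)/(t s)`. -/
noncomputable def hCoeff (μ : Measure ℝ) (n : ℕ) : ℝ :=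
  (n : ℝ) / 2 * ∑ ts ∈ (Finset.HasAntidiagonal.antidiagonal n).filter (fun ts => 1 ≤ ts.1 ∧ 1 ≤ ts.2),
    ∑ σ ∈ annularNC ts.1 ts.2, cycleProd (freeCumulant μ) σ / ((ts.1 : ℝ) * (ts.2 : ℝ))

/-! ### Real-rooted polynomials and finite-free cumulants -/

/-- `p` belongs to `𝒫_d(ℝ)`: it is monic of degree `d` and all its roots are real. -/
def IsMonicRealRooted (d : ℕ) (p : Polynomial ℝ) : Prop :=
  p.Monic ∧ p.natDegree = d ∧ p.Splits

/-- The `n`-th moment of the root distribution: `(1/d) ∑ λ_i(p)^n`, roots with multiplicity,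
where `d` is the degree of `p`. -/
noncomputable def rootMoment (p : Polynomial ℝ) (n : ℕ) : ℝ :=
  (1 / (p.natDegree : ℝ)) * (p.roots.map fun x => x ^ n).sum

/-- The normalized coefficients `a_k` in `p = ∑_{k ≤ d} (-1)^k (d choose k) a_k x^{d-k}`
(used for `k ≤ d`), where `d` is the degree of `p`. -/
noncomputable def normCoeff (p : Polynomial ℝ) (k : ℕ) : ℝ :=
  (-1) ^ k * p.coeff (p.natDegree - k) / (p.natDegree.choose k : ℝ)

/-- The finite-free cumulants (used for `1 ≤ n ≤ d`)
`κ_n(p) = (-d)^{n-1}/(n-1)! ∑_{π ∈ P(n)} (-1)^{|π|-1} (|π|-1)! ∏_{V ∈ π} a_{|V|}`. -/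
noncomputable def finiteFreeCumulant (p : Polynomial ℝ) (n : ℕ) : ℝ :=
  (-(p.natDegree : ℝ)) ^ (n - 1) / ((n - 1).factorial : ℝ) *
    ∑ π : SetPartition n, (-1) ^ (π.parts.card - 1) * ((π.parts.card - 1).factorial : ℝ) *
      ∏ V ∈ π.parts, normCoeff p V.card

/-! ### Infinitesimal distributions and cumulant fluctuations -/

/-- The sequence of real-rooted polynomials `(p_d)_{d ≥ 1}` has infinitesimal distribution
`(μ, μ')` (the value `p 0` plays no role). -/
structure HasInfinitesimalDistribution (p : ℕ → Polynomial ℝ) (μ : Measure ℝ)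
    (μ' : Polynomial ℝ →ₗ[ℝ] ℝ) : Prop where
  realRooted : ∀ d, 1 ≤ d → IsMonicRealRooted d (p d)
  isProbabilityMeasure : IsProbabilityMeasure μ
  finite_moments : ∀ n : ℕ, Integrable (fun x : ℝ => x ^ n) μ
  tendsto_moment : ∀ n : ℕ, Tendsto (fun d => rootMoment (p d) n) atTop (𝓝 (measMoment μ n))
  tendsto_infinitesimal : ∀ n : ℕ,
    Tendsto (fun d : ℕ => (d : ℝ) * (rootMoment (p d) n - measMoment μ n)) atTop
      (𝓝 (μ' (Polynomial.X ^ n)))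

/-- The cumulant fluctuation `r̂_n(p) = lim_d d (κ_n(p_d) - r_n(μ))`, `n ≥ 1`. -/
noncomputable def cumulantFluctuation (p : ℕ → Polynomial ℝ) (μ : Measure ℝ) (n : ℕ) : ℝ :=
  limUnder atTop fun d : ℕ => (d : ℝ) * (finiteFreeCumulant (p d) n - freeCumulant μ n)

/-! ### Formal power series

Formal power series in `w = z⁻¹` are elements of `PowerSeries ℝ` with `PowerSeries.X` playing the
role of `w`; formal power series in `z` are elements of `PowerSeries ℝ` with `PowerSeries.X`
playing the role of `z`. -/

/-- The series `∑_{n ≥ 0} a_n z^{-n-1}`, as a power series in `z⁻¹`. -/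
noncomputable def cauchySeries (a : ℕ → ℝ) : PowerSeries ℝ :=
  PowerSeries.X * PowerSeries.mk a

/-- The formal derivative with respect to `z` of a power series in `w = z⁻¹`:
`d/dz = -w² d/dw`. -/
noncomputable def derivZ (f : PowerSeries ℝ) : PowerSeries ℝ :=
  -(PowerSeries.X ^ 2 * PowerSeries.derivative ℝ f)

/-- `d/dz ∑ a_n z^{-n} = ∑ (-n) a_n z^{-n-1}`. -/
theorem coeff_succ_derivZ (f : PowerSeries ℝ) (n : ℕ) :
    PowerSeries.coeff (n + 1) (derivZ f) = -(n : ℝ) * PowerSeries.coeff n f := by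
  cases n with
  | zero => simp [derivZ, PowerSeries.coeff_X_pow_mul']
  | succ k =>
    simp only [derivZ, map_neg, show k + 1 + 1 = k + 2 from rfl, PowerSeries.coeff_X_pow_mul,
      PowerSeries.coeff_derivative]
    push_cast
    ring

/-- The Cauchy transform `G_μ(z) = ∑_{n ≥ 0} m_n(μ) z^{-n-1}`, a power series in `z⁻¹`. -/
noncomputable def cauchyTransform (μ : Measure ℝ) : PowerSeries ℝ := cauchySeries (measMoment μ)

/-- The infinitesimal Cauchy transform `G_{μ'}(z) = ∑_{n ≥ 0} μ'(x^n) z^{-n-1}`, a power series in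
`z⁻¹` (its term `n = 0` vanishes when `μ'(1) = 0`). -/
noncomputable def infCauchyTransform (μ' : Polynomial ℝ →ₗ[ℝ] ℝ) : PowerSeries ℝ :=
  cauchySeries fun n => μ' (Polynomial.X ^ n)

/-- The transform `R̂_p(z) = ∑_{n ≥ 1} r̂_n(p) z^{n-1}`, a power series in `z`. -/
noncomputable def fluctuationTransform (p : ℕ → Polynomial ℝ) (μ : Measure ℝ) : PowerSeries ℝ :=
  PowerSeries.mk fun n => cumulantFluctuation p μ (n + 1)

/-- The `H`-transform `H_μ(z) = ∑_{n ≥ 2} h_n(μ) z^{-n-1}`, a power series in `z⁻¹`. -/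
noncomputable def hTransform (μ : Measure ℝ) : PowerSeries ℝ :=
  cauchySeries fun n => if 2 ≤ n then hCoeff μ n else 0

/-- `G_μ` has no constant term in `z⁻¹`, so it can be substituted into any power series. -/
theorem hasSubst_cauchyTransform (μ : Measure ℝ) : PowerSeries.HasSubst (cauchyTransform μ) :=
  PowerSeries.HasSubst.of_constantCoeff_zero' (by simp [cauchyTransform, cauchySeries])

end FiniteFree

/-!
Give a transitive pair `(σ, τ)` of permutations of `[n]` the weight `ε ^ (n + 1 - |σ| - |τ|) κ_σ`.
With `ε = -1/d` and `κ_j = κ_j(p)`, the sum of these weights divided by `(n - 1)!` is the root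
moment `m_n(p)`, for `n ≤ d`: removing the transitivity amounts to exponentiating, and turns this
into Newton's identities. For every `ε` these sums satisfy `M = 1 + ∑ κ_j x^j M_j`, where `M_j` is a
deformation of `M^j`. There `κ_n` first occurs with the factor `∏_{i < n} (1 + i ε)`, hence is
determined by the moments, and an expansion of the moments to first order in `1/d` gives one of
`κ_n(p_d)`. The equation then holds over the dual numbers, `1/d` becoming `eps` and `ε` becoming
`-eps`.

The constant term in `ε` is the sum over non-crossing partitions, so the limits of the cumulants
are the free cumulants. The linear term comes from the pairs with one cycle less, which are the
annular non-crossing permutations, and gives `H_μ`. The remaining part of `G_{μ'}` is the derivative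
of `G_μ`, as a function of the free cumulants, in the direction `r̂`; differentiating
`M = 1 + ∑ κ_j x^j M^j` identifies it as `-(R̂ ∘ G_μ) G_μ'`.
-/

namespace FiniteFree

/-! ### Set partitions and cumulants -/

section SetPartitions

variable {α : Type*}

/-- `P` is a partition of the finite set `S` into non-empty blocks. Compared with `Finpartition S`,
the ground set is not part of the type, so that blocks can be added, removed and transported. -/
structure IsPartitionOf (P : Finset (Finset α)) (S : Finset α) : Prop where
  nonempty : ∀ V ∈ P, V.Nonempty
  mem_iff : ∀ x, x ∈ S ↔ ∃ V ∈ P, x ∈ V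
  eq_of_mem : ∀ V ∈ P, ∀ W ∈ P, ∀ x, x ∈ V → x ∈ W → V = W

namespace IsPartitionOf

variable {S T V : Finset α} {P Q : Finset (Finset α)}

theorem subset (h : IsPartitionOf P S) (hV : V ∈ P) : V ⊆ S :=
  fun x hx => (h.mem_iff x).2 ⟨V, hV, hx⟩

theorem insert [DecidableEq α] (h : IsPartitionOf Q (S \ V)) (hVS : V ⊆ S) (hV : V.Nonempty) :
    IsPartitionOf (insert V Q) S where
  nonempty W hW := (Finset.mem_insert.1 hW).elim (fun hWV => hWV ▸ hV) (h.nonempty W)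
  mem_iff x := by
    have := h.mem_iff x
    by_cases hx : x ∈ V <;> grind
  eq_of_mem W hW W' hW' x hxW hxW' := by
    have := h.mem_iff x
    have := h.eq_of_mem
    grind

theorem erase [DecidableEq α] (h : IsPartitionOf P S) (hV : V ∈ P) :
    IsPartitionOf (P.erase V) (S \ V) where
  nonempty W hW := h.nonempty W (Finset.mem_of_mem_erase hW)
  mem_iff x := by grind [h.mem_iff x, h.eq_of_mem]
  eq_of_mem := by grind [h.eq_of_mem]

theorem notMem_of_sdiff [DecidableEq α] (h : IsPartitionOf Q (S \ V)) (hV : V.Nonempty) :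
    V ∉ Q := by
  obtain ⟨x, hx⟩ := hV
  exact fun hVQ => (Finset.mem_sdiff.1 (h.subset hVQ hx)).2 hx

end IsPartitionOf

open scoped Classical in
/-- The set of all partitions of `S`. -/
noncomputable def setPartitions (S : Finset α) : Finset (Finset (Finset α)) :=
  {P ∈ S.powerset.powerset | IsPartitionOf P S}

theorem mem_setPartitions {S : Finset α} {P : Finset (Finset α)} :
    P ∈ setPartitions S ↔ IsPartitionOf P S := by
  simp only [setPartitions, Finset.mem_filter, Finset.mem_powerset, and_iff_right_iff_imp]
  exact fun h V hV => Finset.mem_powerset.2 (h.subset hV)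

theorem setPartitions_empty : setPartitions (∅ : Finset α) = {∅} := by
  ext P
  rw [mem_setPartitions, Finset.mem_singleton]
  constructor
  · intro h
    refine Finset.eq_empty_of_forall_notMem fun V hV => ?_
    obtain ⟨x, hx⟩ := h.nonempty V hV
    exact Finset.notMem_empty x (h.subset hV hx)
  · rintro rfl
    exact ⟨by simp, by simp, by simp⟩

theorem isPartitionOf_parts [DecidableEq α] {S : Finset α} (π : Finpartition S) :
    IsPartitionOf π.parts S where
  nonempty _ hV := π.nonempty_of_mem_parts hV
  mem_iff _ := ⟨π.exists_mem, fun ⟨_, hV, hx⟩ => π.le hV hx⟩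
  eq_of_mem _ hV _ hW _ hxV hxW := π.eq_of_mem_parts hV hW hxV hxW

theorem sum_finpartition {M : Type*} [DecidableEq α] [AddCommMonoid M] {S : Finset α}
    (f : Finset (Finset α) → M) :
    ∑ π : Finpartition S, f π.parts = ∑ P ∈ setPartitions S, f P := by
  refine Finset.sum_bij (fun π _ => π.parts)
    (fun π _ => mem_setPartitions.2 (isPartitionOf_parts π))
    (fun π _ ρ _ h => Finpartition.ext h) (fun P hP => ?_) fun _ _ => rfl
  have h := mem_setPartitions.1 hP
  refine ⟨Finpartition.ofExistsUnique P (fun V hV => h.subset hV) (fun x hx => ?_) fun h₀ =>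
    Finset.not_nonempty_empty (h.nonempty _ h₀), Finset.mem_univ _, rfl⟩
  obtain ⟨V, hV, hxV⟩ := (h.mem_iff x).1 hx
  exact ⟨V, ⟨hV, hxV⟩, fun W hW => h.eq_of_mem W hW.1 V hV x hW.2 hxV⟩

theorem sum_setPartitions_sum_block [DecidableEq α] {M : Type*} [AddCommMonoid M] (S : Finset α)
    (f : Finset α → Finset (Finset α) → M) :
    ∑ P ∈ setPartitions S, ∑ V ∈ P, f V (P.erase V)
      = ∑ V ∈ S.powerset with V.Nonempty, ∑ Q ∈ setPartitions (S \ V), f V Q := by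
  rw [Finset.sum_sigma', Finset.sum_sigma']
  refine Finset.sum_bij' (fun p _ => ⟨p.2, p.1.erase p.2⟩) (fun q _ => ⟨insert q.1 q.2, q.1⟩)
    ?_ ?_ ?_ ?_ fun _ _ => rfl
  · rintro ⟨P, V⟩ h
    simp only [Finset.mem_sigma, mem_setPartitions, Finset.mem_filter, Finset.mem_powerset] at h ⊢
    exact ⟨⟨h.1.subset h.2, h.1.nonempty V h.2⟩, h.1.erase h.2⟩
  · rintro ⟨V, Q⟩ h
    simp only [Finset.mem_sigma, mem_setPartitions, Finset.mem_filter, Finset.mem_powerset] at h ⊢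
    exact ⟨h.2.insert h.1.1 h.1.2, Finset.mem_insert_self V Q⟩
  · rintro ⟨P, V⟩ h
    simp only [Finset.insert_erase (Finset.mem_sigma.1 h).2]
  · rintro ⟨V, Q⟩ h
    simp only [Finset.mem_sigma, mem_setPartitions, Finset.mem_filter] at h
    simp only [Finset.erase_insert (h.2.notMem_of_sdiff h.1.2)]

theorem sum_setPartitions_insert [DecidableEq α] {M : Type*} [AddCommMonoid M] {S : Finset α}
    {x : α} (hx : x ∉ S) (g : Finset (Finset α) → M) :
    ∑ P ∈ setPartitions (insert x S), g P
      = ∑ T ∈ S.powerset, ∑ Q ∈ setPartitions (S \ T), g (insert (insert x T) Q) := by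
  have hblock : ∀ P ∈ setPartitions (insert x S),
      g P = ∑ V ∈ P, if x ∈ V then g (insert V (P.erase V)) else 0 := by
    intro P hP
    rw [mem_setPartitions] at hP
    obtain ⟨V, hV, hxV⟩ := (hP.mem_iff x).1 (Finset.mem_insert_self x S)
    rw [Finset.sum_eq_single_of_mem V hV fun W hW hWV =>
      if_neg fun hxW => hWV (hP.eq_of_mem W hW V hV x hxW hxV), if_pos hxV,
      Finset.insert_erase hV]
  rw [Finset.sum_congr rfl hblock, sum_setPartitions_sum_block (insert x S) fun V Q =>
    if x ∈ V then g (insert V Q) else 0, Finset.sum_filter, Finset.sum_powerset_insert hx,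
    Finset.sum_eq_zero, zero_add]
  · refine Finset.sum_congr rfl fun T _ => ?_
    rw [if_pos (Finset.insert_nonempty x T), Finset.insert_sdiff_insert,
      Finset.sdiff_insert_of_notMem hx]
    simp only [Finset.mem_insert_self, if_true]
  · intro T hT
    have hxT : x ∉ T := fun h => hx (Finset.mem_powerset.1 hT h)
    simp only [hxT, if_false, Finset.sum_const_zero, ite_self]

end SetPartitions

section PartitionCumulants

variable {α R : Type*} [CommRing R] (w : Finset α → R) {S : Finset α} {x : α}

/-- The inverse of `w` for the convolution `(u * v)(S) = ∑ T ⊆ S, u T * v (S \ T)`, provided that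
`w ∅ = 1`. -/
noncomputable def partitionInverse (w : Finset α → R) (S : Finset α) : R :=
  ∑ P ∈ setPartitions S, (-1) ^ P.card * (P.card.factorial : R) * ∏ V ∈ P, w V

/-- The joint cumulants whose moments are `w`: the logarithm of `w` for the convolution
`(u * v)(S) = ∑ T ⊆ S, u T * v (S \ T)`. -/
noncomputable def partitionCumulant (w : Finset α → R) (S : Finset α) : R :=
  ∑ P ∈ setPartitions S, (-1) ^ (P.card - 1) * ((P.card - 1).factorial : R) * ∏ V ∈ P, w V

theorem partitionInverse_empty : partitionInverse w ∅ = 1 := by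
  simp [partitionInverse, setPartitions_empty]

variable [DecidableEq α]

theorem partitionInverse_of_nonempty (hS : S.Nonempty) :
    partitionInverse w S
      = -∑ V ∈ S.powerset with V.Nonempty, partitionInverse w (S \ V) * w V := by
  have hblocks : ∀ P ∈ setPartitions S, (-1) ^ P.card * (P.card.factorial : R) * ∏ V ∈ P, w V
      = ∑ V ∈ P, -((-1) ^ (P.erase V).card * ((P.erase V).card.factorial : R)
          * (∏ W ∈ P.erase V, w W) * w V) := by
    intro P hP
    obtain ⟨k, hk⟩ : ∃ k, P.card = k + 1 := by
      obtain ⟨x, hx⟩ := hS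
      obtain ⟨V, hV, -⟩ := ((mem_setPartitions.1 hP).mem_iff x).1 hx
      exact Nat.exists_eq_succ_of_ne_zero (Finset.card_ne_zero_of_mem hV)
    have hterm : ∀ V ∈ P, -((-1) ^ (P.erase V).card * ((P.erase V).card.factorial : R)
        * (∏ W ∈ P.erase V, w W) * w V) = (-1) ^ (k + 1) * (k.factorial : R) * ∏ W ∈ P, w W := by
      intro V hV
      rw [Finset.card_erase_of_mem hV, hk, Nat.add_sub_cancel, ← Finset.mul_prod_erase P w hV]
      ring
    rw [Finset.sum_congr rfl hterm, Finset.sum_const, hk, Nat.factorial_succ, nsmul_eq_mul]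
    push_cast
    ring
  rw [partitionInverse, Finset.sum_congr rfl hblocks, sum_setPartitions_sum_block S fun V Q =>
    -((-1) ^ Q.card * (Q.card.factorial : R) * (∏ W ∈ Q, w W) * w V)]
  simp only [partitionInverse, Finset.sum_mul, Finset.sum_neg_distrib]

theorem sum_powerset_sdiff {M : Type*} [AddCommMonoid M] (S : Finset α)
    (f : Finset α → Finset α → M) :
    ∑ T ∈ S.powerset, f T (S \ T) = ∑ T ∈ S.powerset, f (S \ T) T := by
  refine Finset.sum_nbij' (S \ ·) (S \ ·) ?_ ?_ ?_ ?_ ?_ <;> simp +contextual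

theorem sum_powerset_powerset {M : Type*} [AddCommMonoid M] (S : Finset α)
    (f : Finset α → Finset α → Finset α → M) :
    ∑ T ∈ S.powerset, ∑ U ∈ T.powerset, f U (T \ U) (S \ T)
      = ∑ U ∈ S.powerset, ∑ V ∈ (S \ U).powerset, f U V ((S \ U) \ V) := by
  rw [Finset.sum_sigma', Finset.sum_sigma']
  refine Finset.sum_bij' (fun p _ => ⟨p.2, p.1 \ p.2⟩) (fun p _ => ⟨p.1 ∪ p.2, p.1⟩)
    ?_ ?_ ?_ ?_ ?_ <;>
    simp only [Finset.mem_sigma, Finset.mem_powerset, Sigma.forall, and_imp]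
  · exact fun T U hT hU => ⟨hU.trans hT, Finset.sdiff_subset_sdiff hT subset_rfl⟩
  · exact fun U V hU hV => ⟨Finset.union_subset hU (hV.trans Finset.sdiff_subset),
      Finset.subset_union_left⟩
  · exact fun T U _ hU => by rw [Finset.union_sdiff_of_subset hU]
  · exact fun U V _ hV => by
      rw [Finset.union_sdiff_cancel_left (Finset.disjoint_sdiff.mono_right hV)]
  · exact fun T U _ hU => by
      rw [sdiff_sdiff_left, Finset.sup_eq_union, Finset.union_sdiff_of_subset hU]

theorem sum_partitionInverse_mul (hw : w ∅ = 1) (S : Finset α) :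
    ∑ T ∈ S.powerset, partitionInverse w T * w (S \ T) = if S = ∅ then 1 else 0 := by
  rw [sum_powerset_sdiff S fun U V => partitionInverse w U * w V]
  rcases S.eq_empty_or_nonempty with rfl | hS
  · simp [partitionInverse_empty, hw]
  · have hsplit := Finset.sum_filter_add_sum_filter_not S.powerset (·.Nonempty)
      fun T => partitionInverse w (S \ T) * w T
    have hempty : {T ∈ S.powerset | ¬T.Nonempty} = {∅} := by
      ext T
      simp only [Finset.mem_filter, Finset.mem_powerset, Finset.not_nonempty_iff_eq_empty,
        Finset.mem_singleton, and_iff_right_iff_imp]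
      rintro rfl
      exact Finset.empty_subset S
    rw [← hsplit, hempty, Finset.sum_singleton, hw, mul_one, Finset.sdiff_empty,
      partitionInverse_of_nonempty w hS, add_neg_cancel, if_neg hS.ne_empty]

theorem partitionCumulant_insert (hx : x ∉ S) :
    partitionCumulant w (insert x S)
      = ∑ T ∈ S.powerset, w (insert x T) * partitionInverse w (S \ T) := by
  rw [partitionCumulant, sum_setPartitions_insert hx]
  refine Finset.sum_congr rfl fun T _ => ?_
  rw [partitionInverse, Finset.mul_sum]
  refine Finset.sum_congr rfl fun Q hQ => ?_
  have hxQ : insert x T ∉ Q := fun h =>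
    hx (Finset.sdiff_subset ((mem_setPartitions.1 hQ).subset h (Finset.mem_insert_self x T)))
  rw [Finset.card_insert_of_notMem hxQ, Finset.prod_insert hxQ, Nat.add_sub_cancel]
  ring

/-- The derivative `w' = (log w)' * w` of `w = exp (log w)`, the derivation being
`w ↦ w (insert x ·)`. -/
theorem sum_partitionCumulant_mul (hw : w ∅ = 1) (hx : x ∉ S) :
    ∑ T ∈ S.powerset, partitionCumulant w (insert x T) * w (S \ T) = w (insert x S) := by
  have hcumulant : ∀ T ∈ S.powerset, partitionCumulant w (insert x T) * w (S \ T)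
      = ∑ U ∈ T.powerset, w (insert x U) * (partitionInverse w (T \ U) * w (S \ T)) := by
    intro T hT
    rw [partitionCumulant_insert w fun h => hx (Finset.mem_powerset.1 hT h), Finset.sum_mul]
    exact Finset.sum_congr rfl fun U _ => mul_assoc _ _ _
  rw [Finset.sum_congr rfl hcumulant, sum_powerset_powerset S fun U V W =>
    w (insert x U) * (partitionInverse w V * w W)]
  simp only [← Finset.mul_sum, sum_partitionInverse_mul w hw]
  rw [Finset.sum_eq_single_of_mem S (Finset.mem_powerset_self S), Finset.sdiff_self,
    if_pos rfl, mul_one]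
  intro U hU hUS
  rw [if_neg, mul_zero]
  exact fun h => hUS ((Finset.mem_powerset.1 hU).antisymm (Finset.sdiff_eq_empty_iff_subset.1 h))

end PartitionCumulants

/-! ### Sums over non-crossing partitions -/

section SetPartitions

variable {α β M : Type*} [AddCommMonoid M]

theorem isPartitionOf_map (f : α ↪ β) {S : Finset α} {P : Finset (Finset α)} :
    IsPartitionOf (P.map (Finset.mapEmbedding f).toEmbedding) (S.map f) ↔ IsPartitionOf P S := by
  constructor
  · intro h
    refine ⟨fun V hV => ?_, fun x => ?_, fun V hV W hW x hxV hxW => ?_⟩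
    · simpa using h.nonempty (V.map f) (by simpa using hV)
    · simpa using h.mem_iff (f x)
    · simpa using h.eq_of_mem (V.map f) (by simpa using hV) (W.map f) (by simpa using hW) (f x)
        (by simpa using hxV) (by simpa using hxW)
  · intro h
    refine ⟨?_, fun y => ?_, ?_⟩
    · simpa using h.nonempty
    · simp only [Finset.mem_map, h.mem_iff, RelEmbedding.coe_toEmbedding,
        Finset.mapEmbedding_apply, exists_exists_and_eq_and]
      grind
    · intro _ hV _ hW _ hxV hxW
      obtain ⟨V, hVP, rfl⟩ := Finset.mem_map.1 hV
      obtain ⟨W, hWP, rfl⟩ := Finset.mem_map.1 hW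
      obtain ⟨x, hx, rfl⟩ := Finset.mem_map.1 hxV
      rw [h.eq_of_mem V hVP W hWP x hx (by simpa using hxW)]

theorem sum_setPartitions_map (f : α ↪ β) (S : Finset α) (g : Finset (Finset β) → M) :
    ∑ P ∈ setPartitions (S.map f), g P
      = ∑ P ∈ setPartitions S, g (P.map (Finset.mapEmbedding f).toEmbedding) := by
  symm
  refine Finset.sum_bij (fun P _ => P.map (Finset.mapEmbedding f).toEmbedding)
    (fun P hP => ?_) (fun P _ Q _ h => Finset.map_injective _ h) (fun P hP => ?_) fun _ _ => rfl
  · rwa [mem_setPartitions, isPartitionOf_map, ← mem_setPartitions]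
  · rw [mem_setPartitions] at hP
    have hsub : P ⊆ S.powerset.map (Finset.mapEmbedding f).toEmbedding := fun V hV => by
      obtain ⟨W, hW, rfl⟩ := Finset.subset_map_iff.1 (hP.subset hV)
      exact Finset.mem_map_of_mem _ (Finset.mem_powerset.2 hW)
    obtain ⟨Q, -, rfl⟩ := Finset.subset_map_iff.1 hsub
    exact ⟨Q, mem_setPartitions.2 ((isPartitionOf_map f).1 hP), rfl⟩

variable [DecidableEq α]

theorem IsPartitionOf.union {S T : Finset α} {P Q : Finset (Finset α)} (hP : IsPartitionOf P S)
    (hQ : IsPartitionOf Q T) (hST : Disjoint S T) : IsPartitionOf (P ∪ Q) (S ∪ T) where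
  nonempty V hV := (Finset.mem_union.1 hV).elim (hP.nonempty V) (hQ.nonempty V)
  mem_iff x := by
    have := hP.mem_iff x
    have := hQ.mem_iff x
    grind
  eq_of_mem V hV W hW x hxV hxW := by
    have := hP.mem_iff x
    have := hQ.mem_iff x
    have := Finset.disjoint_left.1 hST
    have := hP.eq_of_mem
    have := hQ.eq_of_mem
    grind

theorem IsPartitionOf.filter_subset {S T : Finset α} {P : Finset (Finset α)}
    (hP : IsPartitionOf P (S ∪ T)) (hST : Disjoint S T) (h : ∀ V ∈ P, V ⊆ S ∨ V ⊆ T) :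
    IsPartitionOf (P.filter (· ⊆ S)) S where
  nonempty V hV := hP.nonempty V (Finset.mem_filter.1 hV).1
  mem_iff x := by
    have := hP.mem_iff x
    have := Finset.disjoint_left.1 hST
    grind
  eq_of_mem V hV W hW := hP.eq_of_mem V (Finset.mem_filter.1 hV).1 W (Finset.mem_filter.1 hW).1

theorem sum_setPartitions_union {S T : Finset α} (hST : Disjoint S T)
    (f : Finset (Finset α) → M) :
    ∑ P ∈ setPartitions (S ∪ T) with ∀ V ∈ P, V ⊆ S ∨ V ⊆ T, f P
      = ∑ P ∈ setPartitions S, ∑ Q ∈ setPartitions T, f (P ∪ Q) := by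
  rw [← Finset.sum_product']
  symm
  refine Finset.sum_bij' (fun p _ => p.1 ∪ p.2)
    (fun P _ => (P.filter (· ⊆ S), P.filter (· ⊆ T))) ?_ ?_ ?_ ?_ fun _ _ => rfl <;>
    simp only [Finset.mem_product, mem_setPartitions, Finset.mem_filter, Prod.forall, and_imp]
  · intro P Q hP hQ
    refine ⟨hP.union hQ hST, fun V hV => ?_⟩
    exact (Finset.mem_union.1 hV).imp hP.subset hQ.subset
  · intro P hP h
    exact ⟨hP.filter_subset hST h, (Finset.union_comm S T ▸ hP).filter_subset hST.symm
      fun V hV => (h V hV).symm⟩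
  · intro P Q hP hQ
    have hdisj : ∀ V, V.Nonempty → V ⊆ S → ¬V ⊆ T := fun V ⟨x, hx⟩ hVS hVT =>
      Finset.disjoint_left.1 hST (hVS hx) (hVT hx)
    have := hP.nonempty
    have := hQ.nonempty
    have := @hP.subset
    have := @hQ.subset
    congr 1 <;> grind
  · intro P _ h
    rw [← Finset.filter_or, Finset.filter_true_of_mem h]

end SetPartitions

section NonCrossing

variable {α : Type*} [LinearOrder α]

/-- The non-crossing condition for a family of blocks. -/
def NonCrossing (P : Finset (Finset α)) : Prop :=
  ∀ V ∈ P, ∀ W ∈ P, ∀ a ∈ V, ∀ b ∈ W, ∀ c ∈ V, ∀ d ∈ W, a < b → b < c → c < d → V = W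

/-- No block of `Q` has elements on both sides of an element of `T`. If `x` lies to the left of
everything else, this says that the block `insert x T` does not cross the blocks of `Q`. -/
def Separates (T : Finset α) (Q : Finset (Finset α)) : Prop :=
  ∀ t ∈ T, ∀ W ∈ Q, ∀ b ∈ W, ∀ d ∈ W, b < t → ¬t < d

theorem nonCrossing_insert {x : α} {T : Finset α} {Q : Finset (Finset α)} (hxT : ∀ t ∈ T, x < t)
    (hxQ : ∀ W ∈ Q, ∀ b ∈ W, x < b) (hTQ : ∀ W ∈ Q, Disjoint T W) :
    NonCrossing (insert (insert x T) Q) ↔ NonCrossing Q ∧ Separates T Q := by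
  simp only [Finset.disjoint_left] at hTQ
  constructor
  · intro h
    refine ⟨fun V hV W hW => h V (by simp [hV]) W (by simp [hW]), fun t ht W hW b hb d hd hbt htd =>
      ?_⟩
    have := h (insert x T) (by simp) W (by simp [hW]) x (by simp) b hb t (by simp [ht]) d hd
      (hxQ W hW b hb) hbt htd
    grind
  · rintro ⟨hQ, hT⟩ V hV W hW a ha b hb c hc d hd hab hbc hcd
    rcases Finset.mem_insert.1 hV with rfl | hV <;> rcases Finset.mem_insert.1 hW with rfl | hW
    · rfl
    · have hxb := hxQ W hW b hb
      exact absurd hcd (hT c (by grind) W hW b hb d hd hbc)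
    · have hxa := hxQ V hV a ha
      exact absurd hbc (hT b (by grind) V hV a ha c hc hab)
    · exact hQ V hV W hW a ha b hb c hc d hd hab hbc hcd

theorem nonCrossing_union {P Q : Finset (Finset α)}
    (hPQ : ∀ V ∈ P, ∀ W ∈ Q, ∀ a ∈ V, ∀ b ∈ W, a < b) :
    NonCrossing (P ∪ Q) ↔ NonCrossing P ∧ NonCrossing Q := by
  constructor
  · exact fun h => ⟨fun V hV W hW => h V (by simp [hV]) W (by simp [hW]),
      fun V hV W hW => h V (by simp [hV]) W (by simp [hW])⟩
  · rintro ⟨hP, hQ⟩ V hV W hW a ha b hb c hc d hd hab hbc hcd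
    rcases Finset.mem_union.1 hV with hV | hV <;> rcases Finset.mem_union.1 hW with hW | hW
    · exact hP V hV W hW a ha b hb c hc d hd hab hbc hcd
    · exact absurd hbc (hPQ V hV W hW c hc b hb).not_gt
    · exact absurd hab (hPQ W hW V hV b hb a ha).not_gt
    · exact hQ V hV W hW a ha b hb c hc d hd hab hbc hcd

theorem nonCrossing_map {β : Type*} [LinearOrder β] (f : α ↪o β) {P : Finset (Finset α)} :
    NonCrossing (P.map (Finset.mapEmbedding f.toEmbedding).toEmbedding) ↔ NonCrossing P := by
  simp [NonCrossing]

theorem separates_union {T : Finset α} {P Q : Finset (Finset α)} :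
    Separates T (P ∪ Q) ↔ Separates T P ∧ Separates T Q := by
  simp only [Separates, Finset.mem_union]
  grind

variable {R : Type*} [CommRing R] (u : ℕ → R)

open scoped Classical in
/-- The sum of `u_π` over the non-crossing partitions `π` of `S`. -/
noncomputable def ncSum (S : Finset α) : R :=
  ∑ P ∈ setPartitions S with NonCrossing P, ∏ V ∈ P, u V.card

open scoped Classical in
/-- The sum of `u_π` over the non-crossing partitions `π` of `S` whose blocks do not cross a block
consisting of the elements of `T` and of a point to the left of `S` and `T`. -/
noncomputable def gapSum (T S : Finset α) : R :=
  ∑ P ∈ setPartitions S with NonCrossing P ∧ Separates T P, ∏ V ∈ P, u V.card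

theorem gapSum_empty (S : Finset α) : gapSum u ∅ S = ncSum u S := by
  rw [gapSum, ncSum]
  congr! 3
  simp [Separates]

theorem ncSum_insert {x : α} {S : Finset α} (hx : ∀ y ∈ S, x < y) :
    ncSum u (insert x S) = ∑ T ∈ S.powerset, u (T.card + 1) * gapSum u T (S \ T) := by
  classical
  have hxS : x ∉ S := fun h => lt_irrefl x (hx x h)
  rw [ncSum, Finset.sum_filter, sum_setPartitions_insert hxS]
  refine Finset.sum_congr rfl fun T hT => ?_
  rw [gapSum, Finset.sum_filter, Finset.mul_sum]
  refine Finset.sum_congr rfl fun Q hQ => ?_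
  rw [Finset.mem_powerset] at hT
  have hQS : ∀ W ∈ Q, W ⊆ S \ T := fun W hW => (mem_setPartitions.1 hQ).subset hW
  have hxQ : insert x T ∉ Q := fun h =>
    hxS (Finset.sdiff_subset (hQS _ h (Finset.mem_insert_self x T)))
  rw [nonCrossing_insert (fun t ht => hx t (hT ht))
    (fun W hW b hb => hx b (Finset.sdiff_subset (hQS W hW hb)))
    (fun W hW => Finset.disjoint_sdiff.mono_right (hQS W hW)), Finset.prod_insert hxQ,
    Finset.card_insert_of_notMem fun h => hxS (hT h), mul_ite, mul_zero]
  congr!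

theorem separates_insert_iff {v : α} {A B T : Finset α} {P : Finset (Finset α)}
    (hP : IsPartitionOf P (A ∪ B)) (hA : ∀ a ∈ A, a < v) (hB : ∀ b ∈ B, v < b) :
    Separates (insert v T) P ↔ (∀ V ∈ P, V ⊆ A ∨ V ⊆ B) ∧ Separates T P := by
  have hsub : ∀ V ∈ P, V ⊆ A ∪ B := fun V hV => hP.subset hV
  simp only [Separates, Finset.forall_mem_insert, Finset.subset_iff, Finset.mem_union] at hsub ⊢
  refine and_congr_left fun _ => forall₂_congr fun V hV => ?_
  constructor
  · grind
  · rintro (h | h) b hb d hd hbv hvd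
    · exact (hA d (h hd)).not_gt hvd
    · exact (hB b (h hb)).not_gt hbv

theorem gapSum_insert {v : α} {A B T : Finset α} (hA : ∀ a ∈ A, a < v) (hB : ∀ b ∈ B, v < b)
    (hT : ∀ t ∈ T, v < t) : gapSum u (insert v T) (A ∪ B) = ncSum u A * gapSum u T B := by
  classical
  have hAB : Disjoint A B := Finset.disjoint_left.2 fun x hxA hxB => (hA x hxA).not_gt (hB x hxB)
  have hfilter : {P ∈ setPartitions (A ∪ B) | NonCrossing P ∧ Separates (insert v T) P}
      = {P ∈ {P ∈ setPartitions (A ∪ B) | ∀ V ∈ P, V ⊆ A ∨ V ⊆ B} |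
          NonCrossing P ∧ Separates T P} := by
    rw [Finset.filter_filter]
    refine Finset.filter_congr fun P hP => ?_
    rw [separates_insert_iff (mem_setPartitions.1 hP) hA hB, and_left_comm]
  rw [gapSum, hfilter, Finset.sum_filter, sum_setPartitions_union hAB, ncSum, gapSum,
    Finset.sum_filter, Finset.sum_filter, Finset.sum_mul_sum]
  refine Finset.sum_congr rfl fun P hP => Finset.sum_congr rfl fun Q hQ => ?_
  have hPA : ∀ V ∈ P, V ⊆ A := fun V hV => (mem_setPartitions.1 hP).subset hV
  have hQB : ∀ W ∈ Q, W ⊆ B := fun W hW => (mem_setPartitions.1 hQ).subset hW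
  have hTP : Separates T P := fun t ht W hW b _ d hd _ htd =>
    (hT t ht).not_gt (htd.trans (hA d (hPA W hW hd)))
  have hdisj : Disjoint P Q := Finset.disjoint_left.2 fun V hV hV' => by
    obtain ⟨x, hx⟩ := (mem_setPartitions.1 hP).nonempty V hV
    exact Finset.disjoint_left.1 hAB (hPA V hV hx) (hQB V hV' hx)
  rw [nonCrossing_union fun V hV W hW a ha b hb =>
    (hA a (hPA V hV ha)).trans (hB b (hQB W hW hb)), separates_union, Finset.prod_union hdisj]
  simp only [hTP, true_and, and_assoc, ite_and, ite_mul, mul_ite, zero_mul, mul_zero]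
  split_ifs <;> rfl

theorem ncSum_map {β : Type*} [LinearOrder β] (f : α ↪o β) (S : Finset α) :
    ncSum u (S.map f.toEmbedding) = ncSum u S := by
  classical
  rw [ncSum, ncSum, Finset.sum_filter, sum_setPartitions_map, Finset.sum_filter]
  simp only [nonCrossing_map, Finset.prod_map, RelEmbedding.coe_toEmbedding,
    Finset.mapEmbedding_apply, Finset.card_map]

/-- The moment with free cumulants `u`, that is the sum of `u_π` over `π ∈ NC(n)`. -/
noncomputable def ncMoment (n : ℕ) : R := ncSum u (Finset.univ : Finset (Fin n))

theorem ncSum_eq_ncMoment (S : Finset α) : ncSum u S = ncMoment u S.card := by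
  rw [ncMoment, ← ncSum_map u (S.orderEmbOfFin rfl)]
  congr 1
  exact (Finset.map_orderEmbOfFin_univ S rfl).symm

end NonCrossing

/-! ### The deformed functional equation -/

section CumulantSystem

variable {R S : Type*} [CommRing R] [CommRing S]

theorem coeff_X_mul_derivative (f : PowerSeries R) (n : ℕ) :
    PowerSeries.coeff n (PowerSeries.X * PowerSeries.derivative R f)
      = n * PowerSeries.coeff n f := by
  cases n with
  | zero => simp
  | succ n =>
    rw [PowerSeries.coeff_succ_X_mul, PowerSeries.coeff_derivative, mul_comm]
    push_cast
    rfl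

/-- A deformation of the powers of the power series `M`, which are recovered for `ε = 0`. -/
noncomputable def deformedPow (ε : R) (M : PowerSeries R) : ℕ → PowerSeries R
  | 0 => 1
  | j + 1 => M * deformedPow ε M j + PowerSeries.C ε *
      ((j : PowerSeries R) * deformedPow ε M j
        + PowerSeries.X * PowerSeries.derivative R (deformedPow ε M j))

theorem deformedPow_zero_left (M : PowerSeries R) (j : ℕ) : deformedPow 0 M j = M ^ j := by
  induction j with
  | zero => rw [deformedPow, pow_zero]
  | succ j ih => rw [deformedPow, ih, map_zero, zero_mul, add_zero, pow_succ']

theorem coeff_deformedPow_succ (ε : R) (M : PowerSeries R) (j n : ℕ) :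
    PowerSeries.coeff n (deformedPow ε M (j + 1))
      = ∑ p ∈ Finset.HasAntidiagonal.antidiagonal n, PowerSeries.coeff p.1 M
          * PowerSeries.coeff p.2 (deformedPow ε M j)
        + ε * ((j + n) * PowerSeries.coeff n (deformedPow ε M j)) := by
  rw [deformedPow, map_add, PowerSeries.coeff_mul, PowerSeries.coeff_C_mul, map_add,
    coeff_X_mul_derivative, ← map_natCast (PowerSeries.C (R := R)), PowerSeries.coeff_C_mul,
    add_mul]

theorem coeff_zero_deformedPow (ε : R) {M : PowerSeries R} (hM : PowerSeries.coeff 0 M = 1)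
    (j : ℕ) : PowerSeries.coeff 0 (deformedPow ε M j) = ∏ i ∈ Finset.range j, (1 + ε * i) := by
  induction j with
  | zero => simp [deformedPow]
  | succ j ih =>
    rw [coeff_deformedPow_succ, Finset.prod_range_succ, ih]
    simp only [Finset.HasAntidiagonal.antidiagonal_zero, Finset.sum_singleton, hM, ih,
      Nat.cast_zero, add_zero]
    ring

theorem map_deformedPow (f : R →+* S) (ε : R) (M : PowerSeries R) (j : ℕ) :
    deformedPow (f ε) (M.map f) j = (deformedPow ε M j).map f := by
  induction j with
  | zero => simp [deformedPow]
  | succ j ih =>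
    ext n
    simp [coeff_deformedPow_succ, ih]

theorem coeff_deformedPow_congr (ε : R) {M M' : PowerSeries R} {n : ℕ}
    (h : ∀ i ≤ n, PowerSeries.coeff i M = PowerSeries.coeff i M') (j : ℕ) :
    ∀ i ≤ n, PowerSeries.coeff i (deformedPow ε M j)
      = PowerSeries.coeff i (deformedPow ε M' j) := by
  induction j with
  | zero => exact fun _ _ => rfl
  | succ j ih =>
    intro i hi
    rw [coeff_deformedPow_succ, coeff_deformedPow_succ, ih i hi]
    congr 1
    refine Finset.sum_congr rfl fun p hp => ?_
    have hp := Finset.HasAntidiagonal.mem_antidiagonal.1 hp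
    rw [h p.1 (by omega), ih p.2 (by omega)]

/-- The functional equation `M = 1 + ∑_{j ≥ 1} κ_j x^j M_j`, where `M_j` is the `j`-th deformed
power of `M`. For `ε = 0` it is the relation between the moments and the free cumulants `κ`. -/
structure IsCumulantSystem (ε : R) (κ : ℕ → R) (M : PowerSeries R) : Prop where
  coeff_zero : PowerSeries.coeff 0 M = 1
  coeff_succ (n : ℕ) : PowerSeries.coeff (n + 1) M
    = ∑ j ∈ Finset.range (n + 1), κ (j + 1) * PowerSeries.coeff (n - j) (deformedPow ε M (j + 1))

namespace IsCumulantSystem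

variable {ε : R} {κ : ℕ → R} {M M' : PowerSeries R}

theorem coeff_succ_eq_add (h : IsCumulantSystem ε κ M) (n : ℕ) : PowerSeries.coeff (n + 1) M
    = ∑ j ∈ Finset.range n, κ (j + 1) * PowerSeries.coeff (n - j) (deformedPow ε M (j + 1))
      + κ (n + 1) * ∏ i ∈ Finset.range (n + 1), (1 + ε * i) := by
  rw [h.coeff_succ, Finset.sum_range_succ, Nat.sub_self, coeff_zero_deformedPow ε h.coeff_zero]

theorem unique (h : IsCumulantSystem ε κ M) (h' : IsCumulantSystem ε κ M') : M = M' := by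
  ext n
  induction n using Nat.strong_induction_on with
  | _ n ih =>
    cases n with
    | zero => rw [h.coeff_zero, h'.coeff_zero]
    | succ n =>
      rw [h.coeff_succ, h'.coeff_succ]
      refine Finset.sum_congr rfl fun j _ => ?_
      rw [coeff_deformedPow_congr ε (n := n) (fun i hi => ih i (by omega)) _ _ (Nat.sub_le n j)]

theorem map (h : IsCumulantSystem ε κ M) (f : R →+* S) :
    IsCumulantSystem (f ε) (fun n => f (κ n)) (M.map f) where
  coeff_zero := by rw [PowerSeries.coeff_map, h.coeff_zero, map_one]
  coeff_succ n := by
    simp only [PowerSeries.coeff_map, h.coeff_succ, map_sum, map_mul, map_deformedPow]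

theorem of_map {f : R →+* S} (hf : Function.Injective f)
    (h : IsCumulantSystem (f ε) (fun n => f (κ n)) (M.map f)) : IsCumulantSystem ε κ M where
  coeff_zero := hf <| by
    rw [map_one, ← PowerSeries.coeff_map, h.coeff_zero]
  coeff_succ n := hf <| by
    rw [← PowerSeries.coeff_map, h.coeff_succ]
    simp only [PowerSeries.coeff_map, map_sum, map_mul, map_deformedPow]

end IsCumulantSystem

end CumulantSystem

section Cumulants

variable {R : Type*} [CommRing R]

/-- The solution `κ` of the deformed functional equation with moment series `M`, provided the
numbers `1 + ε i` are units (the junk value of `Ring.inverse` at other elements is `0`). -/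
noncomputable def cumulantSeq (ε : R) (M : PowerSeries R) : ℕ → R
  | 0 => 0
  | n + 1 => Ring.inverse (∏ i ∈ Finset.range (n + 1), (1 + ε * i))
      * (PowerSeries.coeff (n + 1) M - ∑ j : Fin n,
          cumulantSeq ε M (j + 1) * PowerSeries.coeff (n - j) (deformedPow ε M (j + 1)))

theorem isUnit_prod_one_add {ε : R} (hε : ∀ i : ℕ, IsUnit (1 + ε * i)) (n : ℕ) :
    IsUnit (∏ i ∈ Finset.range n, (1 + ε * i)) :=
  (IsUnit.prod_iff).2 fun i _ => hε i

theorem isCumulantSystem_cumulantSeq {ε : R} {M : PowerSeries R}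
    (hε : ∀ i : ℕ, IsUnit (1 + ε * i)) (hM : PowerSeries.coeff 0 M = 1) :
    IsCumulantSystem ε (cumulantSeq ε M) M where
  coeff_zero := hM
  coeff_succ n := by
    rw [Finset.sum_range_succ, Nat.sub_self, coeff_zero_deformedPow ε hM, cumulantSeq,
      mul_right_comm, Ring.inverse_mul_cancel _ (isUnit_prod_one_add hε _), one_mul,
      Finset.sum_range, add_sub_cancel]

theorem IsCumulantSystem.cumulant_unique {ε : R} {κ κ' : ℕ → R} {M : PowerSeries R}
    (hε : ∀ i : ℕ, IsUnit (1 + ε * i)) (h : IsCumulantSystem ε κ M)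
    (h' : IsCumulantSystem ε κ' M) (n : ℕ) : κ (n + 1) = κ' (n + 1) := by
  induction n using Nat.strong_induction_on with
  | _ n ih =>
    have hsum := (h.coeff_succ_eq_add n).symm.trans (h'.coeff_succ_eq_add n)
    rw [Finset.sum_congr rfl fun j hj => by rw [ih j (Finset.mem_range.1 hj)]] at hsum
    exact (isUnit_prod_one_add hε (n + 1)).mul_right_cancel (add_left_cancel hsum)

end Cumulants

section NonCrossing

variable {R : Type*} [CommRing R] (u : ℕ → R)

/-- The generating series of the moments with free cumulants `u`. -/
noncomputable def ncSeries : PowerSeries R := PowerSeries.mk (ncMoment u)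

theorem sum_powersetCard_succ_Ico {M : Type*} [AddCommMonoid M] (a b k : ℕ) (f : Finset ℕ → M) :
    ∑ T ∈ (Finset.Ico a b).powersetCard (k + 1), f T
      = ∑ v ∈ Finset.Ico a b, ∑ T ∈ (Finset.Ico (v + 1) b).powersetCard k, f (insert v T) := by
  induction hn : b - a generalizing a with
  | zero =>
    rw [Finset.Ico_eq_empty_of_le (Nat.sub_eq_zero_iff_le.1 hn), Finset.sum_empty,
      Finset.powersetCard_eq_empty.2 (by simp), Finset.sum_empty]
  | succ n ih =>
    have hab : a < b := by omega
    have ha : a ∉ Finset.Ico (a + 1) b := by simp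
    have hinj : Set.InjOn (insert a) ((Finset.Ico (a + 1) b).powersetCard k : Set (Finset ℕ)) :=
      fun S hS T hT h => by
        rw [← Finset.erase_insert fun h' => ha ((Finset.mem_powersetCard.1 hS).1 h'), h,
          Finset.erase_insert fun h' => ha ((Finset.mem_powersetCard.1 hT).1 h')]
    rw [Finset.sum_eq_sum_Ico_succ_bot hab, ← ih (a + 1) (by omega),
      ← Finset.insert_Ico_add_one_left_eq_Ico hab, Finset.powersetCard_succ_insert ha,
      Finset.sum_union (Finset.disjoint_left.2 fun T hT hT' => ?_), Finset.sum_image hinj, add_comm]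
    obtain ⟨U, -, rfl⟩ := Finset.mem_image.1 hT'
    exact ha ((Finset.mem_powersetCard.1 hT).1 (Finset.mem_insert_self a U))

theorem sum_gapSum (k a b : ℕ) :
    ∑ T ∈ (Finset.Ico a b).powersetCard k, gapSum u T (Finset.Ico a b \ T)
      = PowerSeries.coeff (b - a) (PowerSeries.X ^ k * ncSeries u ^ (k + 1)) := by
  induction k generalizing a with
  | zero => simp [gapSum_empty, ncSum_eq_ncMoment, ncSeries]
  | succ k ih =>
    have hterm : ∀ v ∈ Finset.Ico a b, ∀ T ∈ (Finset.Ico (v + 1) b).powersetCard k,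
        gapSum u (insert v T) (Finset.Ico a b \ insert v T)
          = ncMoment u (v - a) * gapSum u T (Finset.Ico (v + 1) b \ T) := by
      intro v hv T hT
      have hTv := (Finset.mem_powersetCard.1 hT).1
      have hset : Finset.Ico a b \ insert v T = Finset.Ico a v ∪ (Finset.Ico (v + 1) b \ T) := by
        ext x
        have := @hTv x
        simp only [Finset.mem_Ico, Finset.mem_sdiff, Finset.mem_insert, Finset.mem_union] at *
        grind
      rw [hset, gapSum_insert u (fun x hx => (Finset.mem_Ico.1 hx).2)
        (fun x hx => (Finset.mem_Ico.1 (Finset.mem_sdiff.1 hx).1).1)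
        (fun x hx => (Finset.mem_Ico.1 (hTv hx)).1), ncSum_eq_ncMoment, Nat.card_Ico]
    have hsum : ∀ v ∈ Finset.Ico a b, ∑ T ∈ (Finset.Ico (v + 1) b).powersetCard k,
        gapSum u (insert v T) (Finset.Ico a b \ insert v T) = ncMoment u (v - a) *
          PowerSeries.coeff (b - (v + 1)) (PowerSeries.X ^ k * ncSeries u ^ (k + 1)) := by
      intro v hv
      rw [Finset.sum_congr rfl (hterm v hv), ← Finset.mul_sum, ih]
    rw [sum_powersetCard_succ_Ico, Finset.sum_congr rfl hsum, Finset.sum_Ico_eq_sum_range,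
      show PowerSeries.X ^ (k + 1) * ncSeries u ^ (k + 1 + 1) = PowerSeries.X *
        (ncSeries u * (PowerSeries.X ^ k * ncSeries u ^ (k + 1))) by ring]
    cases hn : b - a with
    | zero => simp
    | succ n =>
      rw [PowerSeries.coeff_succ_X_mul, PowerSeries.coeff_mul,
        Finset.Nat.sum_antidiagonal_eq_sum_range_succ fun i j => PowerSeries.coeff i (ncSeries u) *
          PowerSeries.coeff j (PowerSeries.X ^ k * ncSeries u ^ (k + 1))]
      refine Finset.sum_congr rfl fun i _ => ?_
      rw [ncSeries, PowerSeries.coeff_mk, Nat.add_sub_cancel_left,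
        show b - (a + i + 1) = n - i by omega]

theorem isCumulantSystem_ncSeries : IsCumulantSystem 0 u (ncSeries u) where
  coeff_zero := by
    simp [ncSeries, ncMoment, ncSum, setPartitions_empty, NonCrossing, Finset.filter_singleton]
  coeff_succ n := by
    have h0 : Finset.range (n + 1) = insert 0 (Finset.Ico 1 (n + 1)) := by
      rw [Finset.range_eq_Ico, ← Finset.insert_Ico_add_one_left_eq_Ico n.succ_pos, zero_add]
    have hm : PowerSeries.coeff (n + 1) (ncSeries u) = ncSum u (Finset.range (n + 1)) := by
      rw [ncSum_eq_ncMoment, Finset.card_range, ncSeries, PowerSeries.coeff_mk]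
    rw [hm, h0, ncSum_insert u fun y hy => (Finset.mem_Ico.1 hy).1, Finset.sum_powerset,
      Nat.card_Ico, Nat.add_sub_cancel, ← h0]
    refine Finset.sum_congr rfl fun k hk => ?_
    rw [Finset.sum_congr rfl fun T hT => by rw [(Finset.mem_powersetCard.1 hT).2],
      ← Finset.mul_sum, sum_gapSum, deformedPow_zero_left, Nat.add_sub_cancel,
      PowerSeries.coeff_X_pow_mul', if_pos (by simpa [Nat.lt_succ_iff] using hk)]

theorem eq_of_ncSeries_eq {u v : ℕ → R} (h : ncSeries u = ncSeries v)
    (n : ℕ) : u (n + 1) = v (n + 1) :=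
  (isCumulantSystem_ncSeries u).cumulant_unique (fun i => by simp)
    (h ▸ isCumulantSystem_ncSeries v) n

end NonCrossing

/-! ### Cycle counts and the genus inequality -/

section Genus

open Equiv

variable {α β : Type*}

open scoped Classical in
/-- The equivalence relation obtained from `r` by merging the classes of `a` and `b`: it is the
kernel of the map to the quotient by `r`, followed by the map which moves the class of `a` to the
class of `b`. -/
noncomputable def joinPair (r : Setoid α) (a b : α) : Setoid α :=
  Setoid.ker fun x => Function.update id (⟦a⟧ : Quotient r) ⟦b⟧ ⟦x⟧

theorem le_joinPair (r : Setoid α) (a b : α) : r ≤ joinPair r a b :=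
  fun _ _ h => congrArg _ (Quotient.sound h)

theorem joinPair_rel (r : Setoid α) (a b : α) : joinPair r a b a b := by
  classical
  change Function.update id (⟦a⟧ : Quotient r) ⟦b⟧ ⟦a⟧ = Function.update id ⟦a⟧ ⟦b⟧ ⟦b⟧
  rw [Function.update_self, Function.update_apply, id, ite_self]

theorem joinPair_le {r s : Setoid α} {a b : α} (h : r ≤ s) (hab : s a b) : joinPair r a b ≤ s := by
  classical
  intro x y hxy
  have hfactor : ∀ q : Quotient r, Quotient.map' (s₁ := r) (s₂ := s) id (fun _ _ h' => h h')
      (Function.update id ⟦a⟧ ⟦b⟧ q) = Quotient.map' id (fun _ _ h' => h h') q := by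
    intro q
    rw [Function.update_apply]
    split_ifs with hq
    · exact hq ▸ (Quotient.sound hab).symm
    · rfl
  exact Quotient.exact <| (hfactor ⟦x⟧).symm.trans <| (congrArg _ hxy).trans (hfactor ⟦y⟧)

theorem joinPair_eq_self {r : Setoid α} {a b : α} (h : r a b) : joinPair r a b = r :=
  le_antisymm (joinPair_le le_rfl h) (le_joinPair r a b)

theorem card_quotient_mono [Finite α] {r s : Setoid α} (h : r ≤ s) :
    Nat.card (Quotient s) ≤ Nat.card (Quotient r) :=
  Nat.card_le_card_of_surjective (Quotient.map' id fun _ _ h' => h h')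
    (by rintro ⟨x⟩; exact ⟨Quotient.mk'' x, rfl⟩)

theorem card_quotient_top [Nonempty α] : Nat.card (Quotient (⊤ : Setoid α)) = 1 := by
  rw [Nat.card_eq_one_iff_unique]
  refine ⟨⟨?_⟩, ⟨Quotient.mk _ (Classical.arbitrary α)⟩⟩
  rintro ⟨x⟩ ⟨y⟩
  exact Quotient.sound trivial

theorem card_quotient_joinPair [Finite α] {r : Setoid α} {a b : α} (h : ¬ r a b) :
    Nat.card (Quotient (joinPair r a b)) + 1 = Nat.card (Quotient r) := by
  classical
  have hab : (⟦b⟧ : Quotient r) ≠ ⟦a⟧ := fun h' => h (r.symm (Quotient.exact h'))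
  have hrange : Set.range (fun x => Function.update id (⟦a⟧ : Quotient r) ⟦b⟧ ⟦x⟧) = {⟦a⟧}ᶜ := by
    ext q
    rw [Set.mem_range, Set.mem_compl_singleton_iff]
    constructor
    · rintro ⟨x, rfl⟩
      rw [Function.update_apply]
      split_ifs with hx
      exacts [hab, hx]
    · intro hq
      obtain ⟨x, rfl⟩ := Quotient.exists_rep q
      exact ⟨x, Function.update_of_ne hq _ _⟩
  rw [joinPair, Nat.card_congr (Setoid.quotientKerEquivRange _), hrange,
    Nat.card_coe_set_eq, Set.ncard_compl, Set.ncard_singleton]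
  exact Nat.sub_add_cancel (Nat.card_pos_iff.2 ⟨⟨⟦a⟧⟩, inferInstance⟩)

theorem card_quotient_le_joinPair [Finite α] (r : Setoid α) (a b : α) :
    Nat.card (Quotient r) ≤ Nat.card (Quotient (joinPair r a b)) + 1 := by
  by_cases h : r a b
  · rw [joinPair_eq_self h]
    exact Nat.le_succ _
  · exact (card_quotient_joinPair h).ge

theorem sameCycle_setoid_le_iff {σ : Perm α} {s : Setoid α} :
    Perm.SameCycle.setoid σ ≤ s ↔ ∀ x, s x (σ x) := by
  refine ⟨fun h x => h (show σ.SameCycle x (σ x) from ⟨1, by simp⟩), ?_⟩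
  rintro h x y ⟨i, rfl⟩
  have hstep : ∀ y, s x y ↔ s x (σ y) := fun y =>
    ⟨fun h' => s.trans h' (h y), fun h' => s.trans h' (s.symm (h y))⟩
  induction i with
  | zero => exact s.refl x
  | succ n ih => rwa [add_comm, zpow_add, zpow_one, Perm.mul_apply, ← hstep]
  | pred n ih => rwa [hstep, ← Perm.mul_apply, ← zpow_one_add, add_sub_cancel]

theorem sameCycle_setoid_apply (σ : Perm α) (x : α) : Perm.SameCycle.setoid σ x (σ x) :=
  sameCycle_setoid_le_iff.1 le_rfl x

theorem setoid_swap_mul_le [DecidableEq α] (σ : Perm α) (a b : α) :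
    Perm.SameCycle.setoid (swap a b * σ) ≤ joinPair (Perm.SameCycle.setoid σ) a b := by
  rw [sameCycle_setoid_le_iff]
  intro x
  have h := le_joinPair _ a b (sameCycle_setoid_apply σ x)
  have hab := joinPair_rel (Perm.SameCycle.setoid σ) a b
  rw [Perm.mul_apply]
  rw [swap_apply_def]
  split_ifs with ha hb
  · exact Setoid.trans' _ (ha ▸ h) hab
  · exact Setoid.trans' _ (hb ▸ h) (Setoid.symm' _ hab)
  · exact h

theorem sameCycle_swap_mul [DecidableEq α] [Finite α] {σ : Perm α} {a b : α}
    (h : ¬ σ.SameCycle a b) : (swap a b * σ).SameCycle a b := by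
  by_contra hab
  have hstep : ∀ x, (swap a b * σ).SameCycle a x → σ.SameCycle a x →
      σ x ≠ a ∧ (swap a b * σ).SameCycle a (σ x) := by
    intro x hx hσx
    have hτx : (swap a b * σ).SameCycle a (swap a b (σ x)) := Perm.sameCycle_apply_right.2 hx
    have hb : σ x ≠ b := fun hb => h (hb ▸ Perm.sameCycle_apply_right.2 hσx)
    have ha : σ x ≠ a := fun ha => hab (by rwa [ha, swap_apply_left] at hτx)
    exact ⟨ha, by rwa [swap_apply_of_ne_of_ne ha hb] at hτx⟩
  have hpow : ∀ n : ℕ, (swap a b * σ).SameCycle a ((σ ^ n) a) := by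
    intro n
    induction n with
    | zero => exact Perm.SameCycle.refl _ a
    | succ n ih =>
      rw [pow_succ', Perm.mul_apply]
      exact (hstep _ ih ⟨n, by simp⟩).2
  apply (hstep _ (hpow (orderOf σ - 1)) ⟨(orderOf σ - 1 : ℕ), by simp⟩).1
  rw [← Perm.mul_apply, mul_pow_sub_one (orderOf_pos σ).ne', pow_orderOf_eq_one, Perm.one_apply]

theorem setoid_swap_mul [DecidableEq α] [Finite α] {σ : Perm α} {a b : α}
    (h : ¬ σ.SameCycle a b) :
    Perm.SameCycle.setoid (swap a b * σ) = joinPair (Perm.SameCycle.setoid σ) a b := by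
  refine le_antisymm (setoid_swap_mul_le σ a b) (joinPair_le ?_ (sameCycle_swap_mul h))
  have hle := setoid_swap_mul_le (swap a b * σ) a b
  rwa [← mul_assoc, swap_mul_self, one_mul, joinPair_eq_self (sameCycle_swap_mul h)] at hle

/-- The number of cycles of a permutation of a finite type, fixed points included. -/
noncomputable def cycleCount (σ : Perm α) : ℕ :=
  Nat.card (Quotient (Perm.SameCycle.setoid σ))

theorem cycleCount_swap_mul [DecidableEq α] [Finite α] {σ : Perm α} {a b : α}
    (h : ¬ σ.SameCycle a b) : cycleCount (swap a b * σ) + 1 = cycleCount σ := by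
  rw [cycleCount, setoid_swap_mul h]
  exact card_quotient_joinPair h

theorem cycleCount_swap_mul_le [DecidableEq α] [Finite α] (σ : Perm α) (a b : α) :
    cycleCount (swap a b * σ) ≤ cycleCount σ + 1 := by
  have h := setoid_swap_mul_le (swap a b * σ) a b
  rw [← mul_assoc, swap_mul_self, one_mul] at h
  exact (card_quotient_le_joinPair _ a b).trans (Nat.add_le_add_right (card_quotient_mono h) 1)

theorem cycleCount_one [Fintype α] : cycleCount (1 : Perm α) = Fintype.card α := by
  rw [← Nat.card_eq_fintype_card]
  refine Nat.card_congr (Equiv.ofBijective (Quotient.mk _) ⟨?_, ?_⟩).symm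
  · intro x y h
    exact Perm.sameCycle_one.1 (Quotient.exact h)
  · exact Quotient.exists_rep

theorem cycleCount_pos [Finite α] [Nonempty α] (σ : Perm α) : 0 < cycleCount σ := by
  have : Nonempty (Quotient (Perm.SameCycle.setoid σ)) := ⟨Quotient.mk _ (Classical.arbitrary α)⟩
  exact Nat.card_pos

/-- The equivalence relation whose classes are the orbits of the group generated by two
permutations. -/
def orbitSetoid (σ τ : Perm α) : Setoid α := Perm.SameCycle.setoid σ ⊔ Perm.SameCycle.setoid τ

theorem orbitSetoid_le_iff {σ τ : Perm α} {s : Setoid α} :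
    orbitSetoid σ τ ≤ s ↔ (∀ x, s x (σ x)) ∧ ∀ x, s x (τ x) := by
  rw [orbitSetoid, sup_le_iff, sameCycle_setoid_le_iff, sameCycle_setoid_le_iff]

theorem orbitSetoid_left (σ τ : Perm α) (x : α) : orbitSetoid σ τ x (σ x) :=
  (orbitSetoid_le_iff.1 le_rfl).1 x

theorem orbitSetoid_right (σ τ : Perm α) (x : α) : orbitSetoid σ τ x (τ x) :=
  (orbitSetoid_le_iff.1 le_rfl).2 x

theorem orbitSetoid_one_right (σ : Perm α) : orbitSetoid σ 1 = Perm.SameCycle.setoid σ :=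
  le_antisymm
    (orbitSetoid_le_iff.2 ⟨sameCycle_setoid_apply σ, fun _ => Setoid.refl' _ _⟩) le_sup_left

theorem setoid_mul_le_orbitSetoid (σ τ : Perm α) :
    Perm.SameCycle.setoid (τ * σ) ≤ orbitSetoid σ τ :=
  sameCycle_setoid_le_iff.2 fun x =>
    Setoid.trans' _ (orbitSetoid_left σ τ x) (orbitSetoid_right σ τ (σ x))

theorem orbitSetoid_le_comap {σ τ : Perm α} {σ' τ' : Perm β} {f : α → β}
    (hσ : Function.Semiconj f σ σ') (hτ : Function.Semiconj f τ τ') :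
    orbitSetoid σ τ ≤ (orbitSetoid σ' τ').comap f :=
  orbitSetoid_le_iff.2
    ⟨fun x => by rw [Setoid.comap_rel, hσ.eq]; exact orbitSetoid_left σ' τ' (f x),
      fun x => by rw [Setoid.comap_rel, hτ.eq]; exact orbitSetoid_right σ' τ' (f x)⟩

theorem orbitSetoid_swap_mul [DecidableEq α] [Finite α] (σ : Perm α) {τ : Perm α} {a b : α}
    (h : ¬ τ.SameCycle a b) :
    orbitSetoid σ (swap a b * τ) = joinPair (orbitSetoid σ τ) a b := by
  have hτ := setoid_swap_mul h
  refine le_antisymm (sup_le (le_sup_left.trans (le_joinPair _ a b)) ?_)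
    (joinPair_le (sup_le le_sup_left (le_trans ?_ le_sup_right)) ?_)
  · rw [hτ]
    exact joinPair_le (le_sup_right.trans (le_joinPair _ a b)) (joinPair_rel _ a b)
  · rw [hτ]
    exact le_joinPair _ a b
  · exact (le_sup_right : _ ≤ orbitSetoid σ (swap a b * τ)) (sameCycle_swap_mul h)

theorem genus_inequality_swap_mul [DecidableEq α] [Fintype α] {σ τ : Perm α} {a b : α}
    (h : ¬ τ.SameCycle a b)
    (hgenus : cycleCount σ + cycleCount τ + cycleCount (τ * σ)
      ≤ Fintype.card α + 2 * Nat.card (Quotient (orbitSetoid σ τ))) :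
    cycleCount σ + cycleCount (swap a b * τ) + cycleCount (swap a b * τ * σ)
      ≤ Fintype.card α + 2 * Nat.card (Quotient (orbitSetoid σ (swap a b * τ))) := by
  have hτ := cycleCount_swap_mul h
  rw [orbitSetoid_swap_mul σ h, mul_assoc]
  by_cases hab : orbitSetoid σ τ a b
  · have hστ := cycleCount_swap_mul_le (τ * σ) a b
    rw [joinPair_eq_self hab]
    omega
  · have horbits := card_quotient_joinPair hab
    have hστ := cycleCount_swap_mul fun h' => hab (setoid_mul_le_orbitSetoid σ τ h')
    omega

theorem genus_inequality [Fintype α] (σ τ : Perm α) :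
    cycleCount σ + cycleCount τ + cycleCount (τ * σ)
      ≤ Fintype.card α + 2 * Nat.card (Quotient (orbitSetoid σ τ)) := by
  classical
  induction hn : τ.support.card using Nat.strong_induction_on generalizing τ with
  | _ n ih =>
  by_cases hτ : τ = 1
  · rw [hτ, orbitSetoid_one_right, cycleCount_one, one_mul, cycleCount]
    omega
  · obtain ⟨a, ha⟩ : ∃ a, τ a ≠ a := by
      by_contra! h
      exact hτ (Equiv.ext h)
    have hlt : (swap a (τ a) * τ).support.card < n := hn ▸ Perm.card_support_swap_mul ha
    have hfix : (swap a (τ a) * τ) a = a := by simp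
    have hns : ¬ (swap a (τ a) * τ).SameCycle a (τ a) := by
      rintro ⟨i, hi⟩
      rw [Perm.zpow_apply_eq_self_of_apply_eq_self hfix] at hi
      exact ha hi.symm
    have h := genus_inequality_swap_mul hns (ih _ hlt _ rfl)
    rwa [← mul_assoc, swap_mul_self, one_mul] at h

/-- The group generated by `σ` and `τ` acts transitively. -/
def TransitivePair (σ τ : Perm α) : Prop :=
  MulAction.IsPretransitive (Subgroup.closure ({σ, τ} : Set (Perm α))) α

theorem orbitSetoid_eq_orbitRel (σ τ : Perm α) :
    orbitSetoid σ τ = MulAction.orbitRel (Subgroup.closure ({σ, τ} : Set (Perm α))) α := by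
  refine le_antisymm (orbitSetoid_le_iff.2 ⟨fun x => ?_, fun x => ?_⟩) ?_
  · exact Setoid.symm' _ ⟨⟨σ, Subgroup.subset_closure (by simp)⟩, rfl⟩
  · exact Setoid.symm' _ ⟨⟨τ, Subgroup.subset_closure (by simp)⟩, rfl⟩
  · rintro _ x ⟨⟨g, hg⟩, rfl⟩
    refine Setoid.symm' _ ((?_ : ∀ x, orbitSetoid σ τ x (g x)) x)
    induction hg using Subgroup.closure_induction with
    | mem g hg =>
      rcases hg with rfl | rfl
      exacts [orbitSetoid_left _ _, orbitSetoid_right _ _]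
    | one => exact fun x => Setoid.refl' _ x
    | mul g g' _ _ h h' => exact fun x => Setoid.trans' _ (h' x) (h (g' x))
    | inv g _ h => exact fun x => Setoid.symm' _ (by simpa using h (g⁻¹ x))

theorem transitivePair_iff {σ τ : Perm α} : TransitivePair σ τ ↔ orbitSetoid σ τ = ⊤ := by
  rw [orbitSetoid_eq_orbitRel, TransitivePair, MulAction.isPretransitive_iff, eq_top_iff]
  exact ⟨fun h x y _ => h y x, fun h x y => h (show (⊤ : Setoid α) y x from trivial)⟩

theorem transitivePair_permCongr (e : α ≃ β) {σ τ : Perm α} :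
    TransitivePair (e.permCongr σ) (e.permCongr τ) ↔ TransitivePair σ τ := by
  have hcomap : (orbitSetoid (e.permCongr σ) (e.permCongr τ)).comap e = orbitSetoid σ τ := by
    refine le_antisymm (fun x y hxy => ?_)
      (orbitSetoid_le_comap (fun x => by simp) fun x => by simp)
    have h := orbitSetoid_le_comap (σ' := σ) (τ' := τ) (f := e.symm) (fun x => by simp)
      (fun x => by simp) hxy
    rwa [Setoid.comap_rel, e.symm_apply_apply, e.symm_apply_apply] at h
  rw [transitivePair_iff, transitivePair_iff, ← hcomap, Setoid.eq_top_iff, Setoid.eq_top_iff]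
  simp only [Setoid.comap_rel]
  exact ⟨fun h x y => h _ _, fun h x y => by simpa using h (e.symm x) (e.symm y)⟩

theorem transitivePair_one_iff [Finite α] [Nonempty α] {σ : Perm α} :
    TransitivePair σ 1 ↔ cycleCount σ = 1 := by
  rw [transitivePair_iff, orbitSetoid_one_right, cycleCount]
  refine ⟨fun h => by rw [h, card_quotient_top], fun h => top_le_iff.1 fun x y _ => ?_⟩
  have := (Nat.card_eq_one_iff_unique.1 h).1
  exact Quotient.exact (Subsingleton.elim _ _)

theorem TransitivePair.genus_le [Fintype α] [Nonempty α] {σ τ : Perm α}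
    (h : TransitivePair σ τ) :
    cycleCount σ + cycleCount τ + cycleCount (τ * σ) ≤ Fintype.card α + 2 := by
  have := genus_inequality σ τ
  rwa [transitivePair_iff.1 h, card_quotient_top] at this

theorem TransitivePair.cycleCount_add_le [Fintype α] [Nonempty α] {σ τ : Perm α}
    (h : TransitivePair σ τ) : cycleCount σ + cycleCount τ ≤ Fintype.card α + 1 := by
  have := h.genus_le
  have := cycleCount_pos (τ * σ)
  omega

end Genus

/-! ### Cycle lengths -/

section CycleLengths

open Equiv

variable {α β : Type*} [DecidableEq α] [Fintype α] [DecidableEq β] [Fintype β]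

/-- The multiset of cycle lengths, fixed points included. -/
def cycleLengths (σ : Perm α) : Multiset ℕ := σ.partition.parts

theorem cycleLengths_eq (σ : Perm α) :
    cycleLengths σ = σ.cycleType + Multiset.replicate (Fintype.card α - σ.support.card) 1 :=
  Perm.parts_partition

theorem sum_cycleLengths (σ : Perm α) : (cycleLengths σ).sum = Fintype.card α :=
  σ.partition.parts_sum

theorem cycleType_permCongr (e : α ≃ β) (σ : Perm α) :
    (e.permCongr σ).cycleType = σ.cycleType := by
  have : e.permCongr σ = σ.extendDomain (p := fun _ => True)
      (e.trans (Equiv.subtypeUnivEquiv (fun _ => trivial)).symm) := by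
    ext x
    obtain ⟨y, rfl⟩ := e.surjective x
    rw [show e y = ((e.trans (Equiv.subtypeUnivEquiv (fun _ => trivial)).symm y :
      {_x : β // True}) : β) from rfl, Perm.extendDomain_apply_image]
    simp
  rw [this, Perm.cycleType_extendDomain]

theorem cycleLengths_permCongr (e : α ≃ β) (σ : Perm α) :
    cycleLengths (e.permCongr σ) = cycleLengths σ := by
  rw [cycleLengths_eq, cycleLengths_eq, ← Perm.sum_cycleType, ← Perm.sum_cycleType,
    cycleType_permCongr, Fintype.card_congr e]

theorem cycleType_sumCongr_one (σ : Perm α) :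
    (Perm.sumCongr σ (1 : Perm β)).cycleType = σ.cycleType := by
  have : Perm.sumCongr σ (1 : Perm β) = σ.extendDomain
      (Equiv.ofInjective (Sum.inl : α → α ⊕ β) Sum.inl_injective) := by
    ext x
    rcases x with x | x
    · rw [show (Sum.inl x : α ⊕ β) = (Equiv.ofInjective (Sum.inl : α → α ⊕ β) Sum.inl_injective x)
        from rfl, Perm.extendDomain_apply_image]
      simp
    · rw [Perm.extendDomain_apply_not_subtype _ _ (by simp)]
      simp
  rw [this, Perm.cycleType_extendDomain]

theorem cycleType_one_sumCongr (τ : Perm β) :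
    (Perm.sumCongr (1 : Perm α) τ).cycleType = τ.cycleType := by
  rw [← cycleType_sumCongr_one (β := α) τ, ← cycleType_permCongr (Equiv.sumComm β α)]
  congr 1
  ext x
  rcases x with x | x <;> simp

theorem cycleType_sumCongr (σ : Perm α) (τ : Perm β) :
    (Perm.sumCongr σ τ).cycleType = σ.cycleType + τ.cycleType := by
  have h : Perm.sumCongr σ τ = Perm.sumCongr σ 1 * Perm.sumCongr 1 τ := by
    rw [Perm.sumCongr_mul, mul_one, one_mul]
  rw [h, Perm.Disjoint.cycleType_mul, cycleType_sumCongr_one, cycleType_one_sumCongr]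
  intro x
  rcases x with x | x <;> simp

theorem cycleLengths_sumCongr (σ : Perm α) (τ : Perm β) :
    cycleLengths (Perm.sumCongr σ τ) = cycleLengths σ + cycleLengths τ := by
  simp only [cycleLengths_eq, ← Perm.sum_cycleType, cycleType_sumCongr, Fintype.card_sum,
    Multiset.sum_add]
  rw [tsub_add_tsub_comm (Perm.sum_cycleType_le σ) (Perm.sum_cycleType_le τ) |>.symm,
    Multiset.replicate_add]
  abel

/-- A complete invariant of the cycle of `σ` through `x`: the point `x` if it is fixed, the cyclic
factor of `σ` moving `x` otherwise. -/
def cycleLabel (σ : Perm α) (x : α) : Perm α ⊕ α :=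
  if σ x = x then Sum.inr x else Sum.inl (σ.cycleOf x)

theorem sameCycle_setoid_eq_ker (σ : Perm α) :
    Perm.SameCycle.setoid σ = Setoid.ker (cycleLabel σ) := by
  ext x y
  change σ.SameCycle x y ↔ cycleLabel σ x = cycleLabel σ y
  unfold cycleLabel
  by_cases hx : σ x = x <;> by_cases hy : σ y = y
  · simp only [if_pos hx, if_pos hy, Sum.inr.injEq]
    exact ⟨fun h => h.eq_of_left hx, fun h => h ▸ Perm.SameCycle.refl σ x⟩
  · simp only [if_pos hx, if_neg hy, reduceCtorEq, iff_false]
    exact fun h => hy (h.apply_eq_self_iff.1 hx)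
  · simp only [if_neg hx, if_pos hy, reduceCtorEq, iff_false]
    exact fun h => hx (h.apply_eq_self_iff.2 hy)
  · simp only [if_neg hx, if_neg hy, Sum.inl.injEq]
    exact Perm.sameCycle_iff_cycleOf_eq_of_mem_support (Perm.mem_support.2 hx)
      (Perm.mem_support.2 hy)

theorem image_cycleLabel (σ : Perm α) :
    Finset.univ.image (cycleLabel σ) = σ.cycleFactorsFinset.disjSum σ.supportᶜ := by
  ext y
  simp only [Finset.mem_image, Finset.mem_univ, true_and, Finset.mem_disjSum, Finset.mem_compl,
    Perm.mem_support, not_not]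
  constructor
  · rintro ⟨x, rfl⟩
    by_cases h : σ x = x
    · exact Or.inr ⟨x, h, by rw [cycleLabel, if_pos h]⟩
    · exact Or.inl ⟨σ.cycleOf x, Perm.cycleOf_mem_cycleFactorsFinset_iff.2 (Perm.mem_support.2 h),
        by rw [cycleLabel, if_neg h]⟩
  · rintro (⟨c, hc, rfl⟩ | ⟨x, hx, rfl⟩)
    · obtain ⟨x, hx⟩ := (Perm.mem_cycleFactorsFinset_iff.1 hc).1.nonempty_support
      have hσx := Perm.mem_support.1 (Perm.mem_cycleFactorsFinset_support_le hc hx)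
      exact ⟨x, by rw [cycleLabel, if_neg hσx, Perm.cycle_is_cycleOf hx hc]⟩
    · exact ⟨x, by rw [cycleLabel, if_pos hx]⟩

theorem card_cycleLengths (σ : Perm α) : Multiset.card (cycleLengths σ) = cycleCount σ := by
  have hcard : cycleCount σ = (Finset.univ.image (cycleLabel σ)).card := by
    rw [cycleCount, sameCycle_setoid_eq_ker, Nat.card_congr (Setoid.quotientKerEquivRange _),
      ← Set.image_univ, ← Finset.coe_univ, ← Finset.coe_image, Nat.card_eq_card_toFinset,
      Finset.toFinset_coe]
  rw [hcard, image_cycleLabel, Finset.card_disjSum, Finset.card_compl, cycleLengths_eq,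
    Multiset.card_add, Multiset.card_replicate, Perm.cycleType_def, Multiset.card_map,
    Finset.card_val]

theorem sign_eq_pow_cycleCount (σ : Perm α) :
    Perm.sign σ = (-1) ^ (Fintype.card α + cycleCount σ) := by
  have h := Perm.sum_cycleType_le σ
  have hparity : Fintype.card α + (Multiset.card σ.cycleType + (Fintype.card α - σ.cycleType.sum))
      = (σ.cycleType.sum + Multiset.card σ.cycleType)
        + 2 * (Fintype.card α - σ.cycleType.sum) := by omega
  rw [Perm.sign_of_cycleType, ← card_cycleLengths, cycleLengths_eq, Multiset.card_add,
    Multiset.card_replicate, ← Perm.sum_cycleType, hparity, pow_add _ _ (2 * _), pow_mul]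
  simp

omit [DecidableEq α] in
theorem even_cycleCount (σ τ : Perm α) :
    Even (Fintype.card α + cycleCount σ + cycleCount τ + cycleCount (τ * σ)) := by
  classical
  have hsign : (-1 : ℤˣ) ^ (Fintype.card α + cycleCount (τ * σ)
      + (Fintype.card α + cycleCount τ + (Fintype.card α + cycleCount σ))) = 1 := by
    rw [pow_add, pow_add _ (_ + cycleCount τ), ← sign_eq_pow_cycleCount, ← sign_eq_pow_cycleCount,
      ← sign_eq_pow_cycleCount, Perm.sign_mul, Int.units_mul_self]
  have heven := (neg_one_pow_eq_one_iff_even (by decide : (-1 : ℤˣ) ≠ 1)).1 hsign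
  rw [Nat.even_iff] at heven ⊢
  omega

end CycleLengths

/-! ### The exponential formula for pairs of permutations -/

section PairWeight

open Equiv

variable {R : Type*} [CommRing R]

/-- A weight on pairs of permutations of finite types, with values in `R`. -/
abbrev PairWeight (R : Type*) : Type _ :=
  ∀ (α : Type) [DecidableEq α] [Fintype α], Perm α → Perm α → R

/-- The weight is invariant under relabelling and multiplicative on disjoint unions. -/
structure PairWeight.IsMultiplicative (W : PairWeight R) : Prop where
  congr : ∀ (α β : Type) [DecidableEq α] [Fintype α] [DecidableEq β] [Fintype β] (e : α ≃ β)
    (σ τ : Perm α), W β (e.permCongr σ) (e.permCongr τ) = W α σ τ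
  sum : ∀ (α β : Type) [DecidableEq α] [Fintype α] [DecidableEq β] [Fintype β]
    (σ τ : Perm α) (σ' τ' : Perm β),
    W (α ⊕ β) (Perm.sumCongr σ σ') (Perm.sumCongr τ τ') = W α σ τ * W β σ' τ'

/-- The sum of the weights of all pairs. -/
noncomputable def pairSum (W : PairWeight R) (α : Type) [DecidableEq α] [Fintype α] : R :=
  ∑ p : Perm α × Perm α, W α p.1 p.2

open scoped Classical in
/-- The sum of the weights of all transitive pairs. -/
noncomputable def transSum (W : PairWeight R) (α : Type) [DecidableEq α] [Fintype α] : R :=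
  ∑ p : Perm α × Perm α with TransitivePair p.1 p.2, W α p.1 p.2

theorem pairSum_congr {W : PairWeight R} (hW : W.IsMultiplicative) {α β : Type} [DecidableEq α]
    [Fintype α] [DecidableEq β] [Fintype β] (e : α ≃ β) : pairSum W α = pairSum W β :=
  Fintype.sum_equiv (e.permCongr.prodCongr e.permCongr) _ _ fun p => (hW.congr α β e p.1 p.2).symm

theorem transSum_congr {W : PairWeight R} (hW : W.IsMultiplicative) {α β : Type} [DecidableEq α]
    [Fintype α] [DecidableEq β] [Fintype β] (e : α ≃ β) : transSum W α = transSum W β := by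
  refine Finset.sum_equiv (e.permCongr.prodCongr e.permCongr) (fun p => ?_)
    fun p _ => (hW.congr α β e p.1 p.2).symm
  simp [transitivePair_permCongr]

open scoped Classical in
/-- The orbit of `x` under the group generated by two permutations. -/
noncomputable def orbitFinset {α : Type*} [Fintype α] (x : α) (p : Perm α × Perm α) : Finset α :=
  Finset.univ.filter fun y => orbitSetoid p.1 p.2 x y

theorem mem_orbitFinset {α : Type*} [Fintype α] {x y : α} {p : Perm α × Perm α} :
    y ∈ orbitFinset x p ↔ orbitSetoid p.1 p.2 x y := by
  simp [orbitFinset]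

theorem orbitSetoid_subtypeCongr_iff {α : Type*} {P : α → Prop} [DecidablePred P] {x y : α}
    (hx : P x) (σ τ : Perm {y // P y}) (σ' τ' : Perm {y // ¬ P y}) :
    orbitSetoid (Perm.subtypeCongr σ σ') (Perm.subtypeCongr τ τ') x y
      ↔ ∃ hy : P y, orbitSetoid σ τ ⟨x, hx⟩ ⟨y, hy⟩ := by
  let orbitLabel (z : α) : Option (Quotient (orbitSetoid σ τ)) :=
    if hz : P z then some ⟦⟨z, hz⟩⟧ else none
  have hinvariant : ∀ (ρ : Perm {y // P y}) (ρ' : Perm {y // ¬ P y}),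
      (∀ z, orbitSetoid σ τ z (ρ z)) →
        ∀ z, orbitLabel z = orbitLabel (Perm.subtypeCongr ρ ρ' z) := by
    intro ρ ρ' hρ z
    by_cases hz : P z
    · rw [Perm.subtypeCongr.left_apply _ _ hz]
      simp only [orbitLabel, dif_pos hz, dif_pos (ρ ⟨z, hz⟩).2]
      exact congrArg some (Quotient.sound (hρ ⟨z, hz⟩))
    · rw [Perm.subtypeCongr.right_apply _ _ hz]
      simp only [orbitLabel, dif_neg hz, dif_neg (ρ' ⟨z, hz⟩).2]
  have hker : orbitSetoid (Perm.subtypeCongr σ σ') (Perm.subtypeCongr τ τ')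
      ≤ Setoid.ker orbitLabel := orbitSetoid_le_iff.2
    ⟨hinvariant σ σ' (orbitSetoid_left σ τ), hinvariant τ τ' (orbitSetoid_right σ τ)⟩
  constructor
  · intro h
    have hxy : orbitLabel x = orbitLabel y := hker h
    by_cases hy : P y
    · simp only [orbitLabel, dif_pos hx, dif_pos hy, Option.some.injEq] at hxy
      exact ⟨hy, Quotient.exact hxy⟩
    · simp [orbitLabel, hx, hy] at hxy
  · rintro ⟨hy, h⟩
    exact orbitSetoid_le_comap (f := Subtype.val) (fun z => (Perm.subtypeCongr.left_apply_subtype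
      σ σ' z).symm) (fun z => (Perm.subtypeCongr.left_apply_subtype τ τ' z).symm) h

theorem orbitFinset_subtypeCongr {α : Type*} [Fintype α] [DecidableEq α] (S : Finset α) {x : α}
    (hx : x ∈ S) (σ τ : Perm {y // y ∈ S}) (σ' τ' : Perm {y // y ∉ S}) :
    orbitFinset x (Perm.subtypeCongr σ σ', Perm.subtypeCongr τ τ') = S ↔ TransitivePair σ τ := by
  simp only [transitivePair_iff, Finset.ext_iff, mem_orbitFinset,
    orbitSetoid_subtypeCongr_iff (P := (· ∈ S)) hx, Setoid.eq_top_iff]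
  exact ⟨fun h y z => Setoid.trans' _ (Setoid.symm' _ ((h y).2 y.2).2) ((h z).2 z.2).2,
    fun h y => ⟨fun hy => hy.1, fun hy => ⟨hy, h _ _⟩⟩⟩

theorem exists_subtypeCongr_eq {α : Type*} {P : α → Prop} [DecidablePred P] {ρ : Perm α}
    (hρ : ∀ y, P (ρ y) ↔ P y) : ∃ (σ : Perm {y // P y}) (σ' : Perm {y // ¬ P y}),
      Perm.subtypeCongr σ σ' = ρ := by
  refine ⟨ρ.subtypePerm hρ, ρ.subtypePerm fun y => not_congr (hρ y), ?_⟩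
  ext y
  by_cases hy : P y
  · rw [Perm.subtypeCongr.left_apply _ _ hy, Perm.subtypePerm_apply]
  · rw [Perm.subtypeCongr.right_apply _ _ hy, Perm.subtypePerm_apply]

theorem sum_orbitFinset_eq {W : PairWeight R} (hW : W.IsMultiplicative) {α : Type} [DecidableEq α]
    [Fintype α] (S : Finset α) {x : α} (hx : x ∈ S) :
    ∑ p : Perm α × Perm α with orbitFinset x p = S, W α p.1 p.2
      = transSum W {y // y ∈ S} * pairSum W {y // y ∉ S} := by
  rw [transSum, pairSum, Finset.sum_mul_sum, ← Finset.sum_product']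
  symm
  refine Finset.sum_bij
    (fun q _ => (Perm.subtypeCongr q.1.1 q.2.1, Perm.subtypeCongr q.1.2 q.2.2)) ?_ ?_ ?_ ?_
  · rintro ⟨⟨σ, τ⟩, ⟨σ', τ'⟩⟩ h
    simp only [Finset.mem_product, Finset.mem_filter, Finset.mem_univ, true_and, and_true] at h ⊢
    exact (orbitFinset_subtypeCongr S hx σ τ σ' τ').2 h
  · rintro ⟨⟨σ, τ⟩, ⟨σ', τ'⟩⟩ _ ⟨⟨ρ, υ⟩, ⟨ρ', υ'⟩⟩ _ e
    simp only [Prod.mk.injEq] at e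
    have h1 := Perm.subtypeCongrHom_injective (fun y => y ∈ S)
      (a₁ := (σ, σ')) (a₂ := (ρ, ρ')) e.1
    have h2 := Perm.subtypeCongrHom_injective (fun y => y ∈ S)
      (a₁ := (τ, τ')) (a₂ := (υ, υ')) e.2
    simp only [Prod.mk.injEq] at h1 h2
    simp [h1, h2]
  · rintro ⟨ρ, υ⟩ hp
    have hp : orbitFinset x (ρ, υ) = S := by simpa using hp
    have hmem : ∀ {y z}, orbitSetoid ρ υ y z → (z ∈ S ↔ y ∈ S) := fun h => by
      rw [← hp, mem_orbitFinset, mem_orbitFinset]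
      exact ⟨fun h' => Setoid.trans' _ h' (Setoid.symm' _ h), fun h' => Setoid.trans' _ h' h⟩
    obtain ⟨σ, σ', rfl⟩ := exists_subtypeCongr_eq fun y => hmem (orbitSetoid_left ρ υ y)
    obtain ⟨τ, τ', rfl⟩ := exists_subtypeCongr_eq fun y => hmem (orbitSetoid_right _ υ y)
    refine ⟨((σ, τ), (σ', τ')), ?_, rfl⟩
    simp only [Finset.mem_product, Finset.mem_filter, Finset.mem_univ, true_and, and_true]
    exact (orbitFinset_subtypeCongr S hx σ τ σ' τ').1 hp
  · rintro ⟨⟨σ, τ⟩, ⟨σ', τ'⟩⟩ _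
    rw [Perm.subtypeCongr, Perm.subtypeCongr, hW.congr, hW.sum]

theorem sum_orbitFinset_erase_eq {W : PairWeight R} (hW : W.IsMultiplicative) {α : Type}
    [DecidableEq α] [Fintype α] {x : α} {T : Finset α} (hx : x ∉ T) :
    ∑ p : Perm α × Perm α with (orbitFinset x p).erase x = T, W α p.1 p.2
      = transSum W (Fin (T.card + 1)) * pairSum W (Fin (Fintype.card α - (T.card + 1))) := by
  have hcard : (insert x T).card = T.card + 1 := Finset.card_insert_of_notMem hx
  have hfilter : ∀ p : Perm α × Perm α,
      (orbitFinset x p).erase x = T ↔ orbitFinset x p = insert x T := fun p =>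
    ⟨fun h => by rw [← h, Finset.insert_erase (mem_orbitFinset.2 (Setoid.refl' _ x))],
      fun h => by rw [h, Finset.erase_insert hx]⟩
  simp only [hfilter]
  rw [sum_orbitFinset_eq hW _ (Finset.mem_insert_self x T),
    transSum_congr hW (Fintype.equivFinOfCardEq ((Fintype.card_coe _).trans hcard)),
    pairSum_congr hW (Fintype.equivFinOfCardEq (n := Fintype.card α - (T.card + 1)) ?_)]
  rw [Fintype.card_subtype_compl, Fintype.card_coe, hcard]

theorem pairSum_succ {W : PairWeight R} (hW : W.IsMultiplicative) (n : ℕ) :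
    pairSum W (Fin (n + 1)) = ∑ j ∈ Finset.range (n + 1),
      n.choose j * transSum W (Fin (j + 1)) * pairSum W (Fin (n - j)) := by
  have hmaps : ∀ p ∈ (Finset.univ : Finset (Perm (Fin (n + 1)) × Perm (Fin (n + 1)))),
      (orbitFinset 0 p).erase 0 ∈ ((Finset.univ : Finset (Fin (n + 1))).erase 0).powerset :=
    fun p _ => Finset.mem_powerset.2 (Finset.erase_subset_erase _ (Finset.subset_univ _))
  have hterm : ∀ T ∈ ((Finset.univ : Finset (Fin (n + 1))).erase 0).powerset,
      ∑ p : Perm (Fin (n + 1)) × Perm (Fin (n + 1)) with (orbitFinset 0 p).erase 0 = T,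
        W (Fin (n + 1)) p.1 p.2
      = transSum W (Fin (T.card + 1)) * pairSum W (Fin (n - T.card)) := by
    intro T hT
    rw [sum_orbitFinset_erase_eq hW fun h =>
      Finset.notMem_erase _ _ (Finset.mem_powerset.1 hT h), Fintype.card_fin,
      Nat.add_sub_add_right]
  rw [pairSum, ← Finset.sum_fiberwise_of_maps_to hmaps, Finset.sum_congr rfl hterm,
    Finset.sum_powerset_apply_card
      (fun j => transSum W (Fin (j + 1)) * pairSum W (Fin (n - j))),
    Finset.card_erase_of_mem (Finset.mem_univ _), Finset.card_univ, Fintype.card_fin,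
    Nat.add_sub_cancel]
  exact Finset.sum_congr rfl fun j _ => by rw [nsmul_eq_mul, mul_assoc]

end PairWeight

/-! ### Permutations weighted by their cycles -/

section CycleWeight

open Equiv

variable {R S : Type*} [CommRing R] [CommRing S] {α β : Type*} [DecidableEq α] [Fintype α]
  [DecidableEq β] [Fintype β]

/-- The product of `u_{|c|}` over the cycles `c` of `σ`, fixed points included. -/
def cycleWeight (u : ℕ → R) (σ : Perm α) : R :=
  ((cycleLengths σ).map u).prod

theorem cycleWeight_permCongr (u : ℕ → R) (e : α ≃ β) (σ : Perm α) :
    cycleWeight u (e.permCongr σ) = cycleWeight u σ := by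
  rw [cycleWeight, cycleLengths_permCongr, cycleWeight]

theorem cycleWeight_sumCongr (u : ℕ → R) (σ : Perm α) (τ : Perm β) :
    cycleWeight u (Perm.sumCongr σ τ) = cycleWeight u σ * cycleWeight u τ := by
  rw [cycleWeight, cycleLengths_sumCongr, Multiset.map_add, Multiset.prod_add, cycleWeight,
    cycleWeight]

theorem cycleWeight_const (N : R) (σ : Perm α) :
    cycleWeight (fun _ => N) σ = N ^ cycleCount σ := by
  rw [cycleWeight, Multiset.map_const', Multiset.prod_replicate, card_cycleLengths]

theorem cycleWeight_const_mul (N : R) (u : ℕ → R) (σ : Perm α) :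
    cycleWeight (fun k => N * u k) σ = N ^ cycleCount σ * cycleWeight u σ := by
  rw [cycleWeight, Multiset.prod_map_mul, ← cycleWeight_const, cycleWeight, cycleWeight]

theorem map_cycleWeight (f : R →+* S) (u : ℕ → R) (σ : Perm α) :
    cycleWeight (fun k => f (u k)) σ = f (cycleWeight u σ) := by
  rw [cycleWeight, cycleWeight, map_multiset_prod, Multiset.map_map, Function.comp_def]

theorem cycleWeight_of_cycleCount_eq_one (u : ℕ → R) {σ : Perm α} (hσ : cycleCount σ = 1) :
    cycleWeight u σ = u (Fintype.card α) := by
  rw [← card_cycleLengths, Multiset.card_eq_one] at hσ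
  obtain ⟨a, ha⟩ := hσ
  have hsum := sum_cycleLengths σ
  rw [ha, Multiset.sum_singleton] at hsum
  rw [cycleWeight, ha, Multiset.map_singleton, Multiset.prod_singleton, hsum]

/-- The sum of the cycle weights of all permutations of `n` elements. -/
def permSum (u : ℕ → R) (n : ℕ) : R := ∑ σ : Perm (Fin n), cycleWeight u σ

theorem permSum_zero (u : ℕ → R) : permSum u 0 = 1 := by
  rw [permSum, Fintype.sum_unique, cycleWeight, cycleLengths_eq]
  simp

theorem permSum_one_left (n : ℕ) : permSum (fun _ => (1 : R)) n = n.factorial := by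
  simp [permSum, cycleWeight_const, Fintype.card_perm]

/-- The weight `(σ, τ) ↦ u_σ v_τ`. -/
def productWeight (u v : ℕ → R) : PairWeight R :=
  fun _ _ _ σ τ => cycleWeight u σ * cycleWeight v τ

theorem isMultiplicative_productWeight (u v : ℕ → R) : (productWeight u v).IsMultiplicative where
  congr α β _ _ _ _ e σ τ := by
    simp only [productWeight, cycleWeight_permCongr]
  sum α β _ _ _ _ σ τ σ' τ' := by
    simp only [productWeight, cycleWeight_sumCongr]
    ring

theorem pairSum_productWeight (u v : ℕ → R) (n : ℕ) :
    pairSum (productWeight u v) (Fin n) = permSum u n * permSum v n := by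
  rw [permSum, permSum, Fintype.sum_mul_sum, ← Fintype.sum_prod_type']
  rfl

/-- The weight `u_σ` on the pairs `(σ, 1)`, extended by zero: it turns sums over pairs of
permutations into sums over permutations. -/
def singleWeight (u : ℕ → R) : PairWeight R :=
  fun _ _ _ σ τ => if τ = 1 then cycleWeight u σ else 0

theorem isMultiplicative_singleWeight (u : ℕ → R) : (singleWeight u).IsMultiplicative where
  congr α β _ _ _ _ e σ τ := by
    have hτ : e.permCongr τ = 1 ↔ τ = 1 := map_eq_one_iff e.permCongrHom
      e.permCongrHom.injective
    simp only [singleWeight, cycleWeight_permCongr, hτ]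
  sum α β _ _ _ _ σ τ σ' τ' := by
    have hτ : Perm.sumCongr τ τ' = 1 ↔ τ = 1 ∧ τ' = 1 := by
      rw [← Perm.sumCongr_one, ← Perm.sumCongrHom_apply α β (τ, τ'), ← Perm.sumCongrHom_apply α β
        (1, 1), Perm.sumCongrHom_injective.eq_iff, Prod.mk.injEq]
    simp only [singleWeight, cycleWeight_sumCongr, hτ, ite_and]
    split_ifs <;> simp

theorem pairSum_singleWeight (u : ℕ → R) (n : ℕ) :
    pairSum (singleWeight u) (Fin n) = permSum u n := by
  simp [pairSum, permSum, Fintype.sum_prod_type, singleWeight]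

theorem transSum_singleWeight_eq_mul (u : ℕ → R) (n : ℕ) :
    transSum (singleWeight u) (Fin (n + 1))
      = u (n + 1) * transSum (singleWeight fun _ => (1 : R)) (Fin (n + 1)) := by
  classical
  rw [transSum, transSum, Finset.mul_sum]
  refine Finset.sum_congr rfl ?_
  rintro ⟨σ, τ⟩ htrans
  replace htrans : TransitivePair σ τ := (Finset.mem_filter.1 htrans).2
  simp only [singleWeight]
  split_ifs with hτ
  · subst hτ
    rw [cycleWeight_const, one_pow, mul_one,
      cycleWeight_of_cycleCount_eq_one u (transitivePair_one_iff.1 htrans), Fintype.card_fin]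
  · rw [mul_zero]

theorem transSum_singleWeight_one (n : ℕ) :
    transSum (singleWeight fun _ => (1 : R)) (Fin (n + 1)) = n.factorial := by
  induction n using Nat.strong_induction_on with
  | _ n ih =>
    have hrec := pairSum_succ (isMultiplicative_singleWeight fun _ => (1 : R)) n
    have hterm : ∀ j ∈ Finset.range n, (n.choose j : R)
        * transSum (singleWeight fun _ => (1 : R)) (Fin (j + 1)) * (n - j).factorial
        = n.factorial := by
      intro j hj
      have hj := Finset.mem_range.1 hj
      rw [ih j hj]
      exact_mod_cast congrArg (Nat.cast (R := R)) (Nat.choose_mul_factorial_mul_factorial hj.le)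
    simp only [pairSum_singleWeight, permSum_one_left] at hrec
    rw [Finset.sum_range_succ, Finset.sum_congr rfl hterm, Finset.sum_const, Finset.card_range,
      nsmul_eq_mul, Nat.choose_self, Nat.sub_self, Nat.factorial_succ] at hrec
    push_cast at hrec
    simp only [Nat.factorial_zero, Nat.cast_one, mul_one, one_mul] at hrec
    linear_combination -hrec

theorem permSum_succ (u : ℕ → R) (n : ℕ) :
    permSum u (n + 1) = ∑ j ∈ Finset.range (n + 1),
      n.descFactorial j * u (j + 1) * permSum u (n - j) := by
  rw [← pairSum_singleWeight, pairSum_succ (isMultiplicative_singleWeight u)]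
  refine Finset.sum_congr rfl fun j _ => ?_
  rw [transSum_singleWeight_eq_mul, transSum_singleWeight_one, pairSum_singleWeight,
    Nat.descFactorial_eq_factorial_mul_choose]
  push_cast
  ring

theorem permSum_const_succ (N : R) (n : ℕ) :
    permSum (fun _ => N) (n + 1) = (N + n) * permSum (fun _ => N) n := by
  cases n with
  | zero => simp [permSum_succ, permSum_zero]
  | succ n =>
    have htail : ∑ j ∈ Finset.range (n + 1), ((n + 1).descFactorial (j + 1) : R) * N
        * permSum (fun _ => N) (n + 1 - (j + 1)) = (n + 1) * permSum (fun _ => N) (n + 1) := by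
      rw [permSum_succ _ n, Finset.mul_sum]
      refine Finset.sum_congr rfl fun j _ => ?_
      rw [Nat.succ_descFactorial_succ, Nat.add_sub_add_right]
      push_cast
      ring
    rw [permSum_succ _ (n + 1), Finset.sum_range_succ', htail, Nat.descFactorial_zero,
      Nat.sub_zero]
    push_cast
    ring

end CycleWeight

/-! ### Sums over transitive pairs solve the deformed functional equation -/

section TransSeries

open Equiv PowerSeries

variable {R S : Type*} [CommRing R] [CommRing S]

theorem coeff_mul_eq_sum_range (f g : R⟦X⟧) (n : ℕ) :
    coeff n (f * g) = ∑ j ∈ Finset.range (n + 1), coeff j f * coeff (n - j) g := by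
  rw [coeff_mul, Finset.Nat.sum_antidiagonal_eq_sum_range_succ
    fun i j => coeff i f * coeff j g]

theorem coeff_mk_sum_mul (f : ℕ → R⟦X⟧) (g : R⟦X⟧) (n : ℕ) :
    coeff n (mk (fun m => ∑ j ∈ Finset.range (m + 1), coeff (m - j) (f j)) * g)
      = ∑ j ∈ Finset.range (n + 1), coeff (n - j) (f j * g) := by
  have hflip := Finset.sum_range_diag_flip (n + 1)
    fun k l => coeff l (f k) * coeff (n - (k + l)) g
  simp only [coeff_mul_eq_sum_range, coeff_mk, Finset.sum_mul]
  refine Eq.trans (Finset.sum_congr rfl fun m _ => Finset.sum_congr rfl fun k hk => ?_)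
    (hflip.trans (Finset.sum_congr rfl fun k hk => ?_))
  · rw [Nat.add_sub_cancel' (Nat.lt_succ_iff.1 (Finset.mem_range.1 hk))]
  · rw [Nat.sub_add_comm (Nat.lt_succ_iff.1 (Finset.mem_range.1 hk))]
    simp only [Nat.sub_sub]

open scoped Classical in
/-- The sum `∑ ε^{n + 1 - |σ| - |τ|} κ_σ` over the transitive pairs `(σ, τ)` of permutations of `n`
elements; for `n ≥ 1` the exponent is never a truncated difference, by the genus inequality. -/
noncomputable def transPoly (ε : R) (κ : ℕ → R) (n : ℕ) : R :=
  ∑ p : Perm (Fin n) × Perm (Fin n) with TransitivePair p.1 p.2,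
    ε ^ (n + 1 - (cycleCount p.1 + cycleCount p.2)) * cycleWeight κ p.1

theorem map_transPoly (f : R →+* S) (ε : R) (κ : ℕ → R) (n : ℕ) :
    transPoly (f ε) (fun j => f (κ j)) n = f (transPoly ε κ n) := by
  simp [transPoly, map_cycleWeight]

/-- The moment series with deformed cumulants `κ`: the coefficient of `x ^ n` is
`transPoly ε κ n / (n - 1)!` for `n ≥ 1`. -/
noncomputable def transSeries [Algebra ℚ R] (ε : R) (κ : ℕ → R) : R⟦X⟧ :=
  mk fun n => if n = 0 then 1 else ((n - 1).factorial : ℚ)⁻¹ • transPoly ε κ n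

theorem coeff_zero_transSeries [Algebra ℚ R] (ε : R) (κ : ℕ → R) :
    coeff 0 (transSeries ε κ) = 1 := by
  simp [transSeries]

theorem coeff_succ_transSeries [Algebra ℚ R] (ε : R) (κ : ℕ → R) (n : ℕ) :
    coeff (n + 1) (transSeries ε κ) = (n.factorial : ℚ)⁻¹ • transPoly ε κ (n + 1) := by
  simp [transSeries]

theorem map_transSeries [Algebra ℚ R] [Algebra ℚ S] (f : R →+* S) (ε : R) (κ : ℕ → R) :
    transSeries (f ε) (fun n => f (κ n)) = (transSeries ε κ).map f := by
  ext n
  cases n with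
  | zero => simp [coeff_zero_transSeries]
  | succ n => rw [coeff_map, coeff_succ_transSeries, coeff_succ_transSeries, map_transPoly,
      map_rat_smul f]

section Field

variable {K : Type*} [Field K] {ε : K}

theorem pow_mul_transSum (hε : ε ≠ 0) (κ : ℕ → K) (n : ℕ) :
    ε ^ (n + 2) * transSum (productWeight (fun k => ε⁻¹ * κ k) fun _ => ε⁻¹) (Fin (n + 1))
      = transPoly ε κ (n + 1) := by
  classical
  rw [transSum, transPoly, Finset.mul_sum]
  refine Finset.sum_congr rfl fun p hp => ?_
  have hgenus := (Finset.mem_filter.1 hp).2.cycleCount_add_le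
  rw [Fintype.card_fin] at hgenus
  rw [productWeight, cycleWeight_const_mul, cycleWeight_const, pow_sub₀ ε hε hgenus, pow_add ε
    (cycleCount _), mul_inv, inv_pow, inv_pow]
  ring

theorem pow_mul_permSum_const (hε : ε ≠ 0) (n : ℕ) :
    ε ^ n * permSum (fun _ => ε⁻¹) n = ∏ i ∈ Finset.range n, (1 + ε * i) := by
  induction n with
  | zero => simp [permSum_zero]
  | succ n ih =>
    rw [permSum_const_succ, Finset.prod_range_succ, ← ih]
    field_simp
    ring

/-- The exponential generating function of all pairs of permutations weighted by their cycles,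
with the rising factorials shifted by `j`: it is the `j`-th deformed power of the moment series
times `risingSeries ε κ 0`. -/
noncomputable def risingSeries (ε : K) (κ : ℕ → K) (j : ℕ) : K⟦X⟧ :=
  mk fun k => (∏ i ∈ Finset.range (k + j), (1 + ε * i)) * permSum (fun i => ε⁻¹ * κ i) k
    / k.factorial

theorem coeff_risingSeries (ε : K) (κ : ℕ → K) (j k : ℕ) :
    coeff k (risingSeries ε κ j) = (∏ i ∈ Finset.range (k + j), (1 + ε * i))
      * permSum (fun i => ε⁻¹ * κ i) k / k.factorial :=
  coeff_mk _ _

theorem coeff_zero_risingSeries (ε : K) (κ : ℕ → K) : coeff 0 (risingSeries ε κ 0) = 1 := by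
  simp [coeff_risingSeries, permSum_zero]

theorem risingSeries_succ (ε : K) (κ : ℕ → K) (j : ℕ) :
    risingSeries ε κ (j + 1) = risingSeries ε κ j + C ε *
      ((j : K⟦X⟧) * risingSeries ε κ j + X * derivative K (risingSeries ε κ j)) := by
  ext k
  rw [map_add, coeff_C_mul, map_add, coeff_X_mul_derivative, ← map_natCast (C (R := K)),
    coeff_C_mul]
  simp only [coeff_risingSeries]
  rw [← add_assoc k j 1, Finset.prod_range_succ]
  push_cast
  ring

variable [Algebra ℚ K]

theorem coeff_succ_transSeries_eq_div (ε : K) (κ : ℕ → K) (n : ℕ) :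
    coeff (n + 1) (transSeries ε κ) = transPoly ε κ (n + 1) / n.factorial := by
  rw [coeff_succ_transSeries, Algebra.smul_def, map_inv₀, map_natCast, inv_mul_eq_div]

theorem coeff_succ_risingSeries_newton (hε : ε ≠ 0) (κ : ℕ → K) (n : ℕ) :
    ε * ((n + 1) * coeff (n + 1) (risingSeries ε κ 0))
      = ∑ j ∈ Finset.range (n + 1),
        coeff (j + 1) (transSeries ε κ) * coeff (n - j) (risingSeries ε κ 0) := by
  have : CharZero K := algebraRat.charZero K
  have hfact : ∀ m : ℕ, (m.factorial : K) ≠ 0 := fun m => Nat.cast_ne_zero.2 m.factorial_ne_zero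
  have hn : (n + 1 : K) ≠ 0 := Nat.cast_add_one_ne_zero n
  have hpair := pairSum_succ (isMultiplicative_productWeight (fun k => ε⁻¹ * κ k) fun _ => ε⁻¹) n
  simp only [pairSum_productWeight] at hpair
  simp only [coeff_risingSeries, coeff_succ_transSeries_eq_div, ← pow_mul_transSum hε,
    ← pow_mul_permSum_const hε, add_zero]
  calc _ = ε ^ (n + 2) / n.factorial
        * (permSum (fun k => ε⁻¹ * κ k) (n + 1) * permSum (fun _ => ε⁻¹) (n + 1)) := by
        rw [Nat.factorial_succ, Nat.cast_mul, Nat.cast_add_one]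
        field_simp [hfact n]
        ring
    _ = _ := by
        rw [hpair, Finset.mul_sum]
        refine Finset.sum_congr rfl fun j hj => ?_
        obtain ⟨k, rfl⟩ := Nat.exists_eq_add_of_le (Nat.lt_succ_iff.1 (Finset.mem_range.1 hj))
        rw [Nat.cast_choose K (Nat.le_add_right j k), Nat.add_sub_cancel_left]
        field_simp [hfact]
        ring

theorem X_mul_derivative_risingSeries (hε : ε ≠ 0) (κ : ℕ → K) :
    C ε * (X * derivative K (risingSeries ε κ 0))
      = (transSeries ε κ - 1) * risingSeries ε κ 0 := by
  ext n
  rw [coeff_C_mul, coeff_X_mul_derivative]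
  cases n with
  | zero => simp [coeff_mul, coeff_zero_transSeries]
  | succ n =>
    rw [Nat.cast_add_one, coeff_succ_risingSeries_newton hε, coeff_mul_eq_sum_range,
      Finset.sum_range_succ' _ (n + 1)]
    have hzero : coeff 0 (transSeries ε κ - 1) = 0 := by
      rw [map_sub, coeff_zero_transSeries, coeff_zero_one, sub_self]
    simp only [hzero, zero_mul, add_zero, map_sub, coeff_one, Nat.add_sub_add_right,
      Nat.add_eq_zero_iff, one_ne_zero, and_false, if_false, sub_zero]

theorem risingSeries_eq (hε : ε ≠ 0) (κ : ℕ → K) (j : ℕ) :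
    risingSeries ε κ j = deformedPow ε (transSeries ε κ) j * risingSeries ε κ 0 := by
  induction j with
  | zero => rw [deformedPow, one_mul]
  | succ j ih =>
    rw [risingSeries_succ, ih, deformedPow, Derivation.leibniz, smul_eq_mul, smul_eq_mul]
    linear_combination deformedPow ε (transSeries ε κ) j * X_mul_derivative_risingSeries hε κ

theorem coeff_succ_risingSeries_cumulant (hε : ε ≠ 0) (κ : ℕ → K) (n : ℕ) :
    ε * ((n + 1) * coeff (n + 1) (risingSeries ε κ 0))
      = ∑ j ∈ Finset.range (n + 1), κ (j + 1) * coeff (n - j) (risingSeries ε κ (j + 1)) := by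
  have : CharZero K := algebraRat.charZero K
  have hfact : ∀ m : ℕ, (m.factorial : K) ≠ 0 := fun m => Nat.cast_ne_zero.2 m.factorial_ne_zero
  have hn : (n + 1 : K) ≠ 0 := Nat.cast_add_one_ne_zero n
  simp only [coeff_risingSeries, add_zero]
  rw [permSum_succ, Finset.mul_sum, Finset.sum_div, Finset.mul_sum, Finset.mul_sum]
  refine Finset.sum_congr rfl fun j hj => ?_
  have hj := Nat.lt_succ_iff.1 (Finset.mem_range.1 hj)
  have hdesc : ((n - j).factorial : K) * n.descFactorial j = n.factorial := by
    rw [← Nat.cast_mul, Nat.factorial_mul_descFactorial hj]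
  rw [← add_assoc, Nat.sub_add_cancel hj, Nat.factorial_succ, Nat.cast_mul, ← hdesc,
    Nat.cast_add_one]
  have hd : (n.descFactorial j : K) ≠ 0 := right_ne_zero_of_mul (hdesc ▸ hfact n)
  field_simp [hfact]

theorem isCumulantSystem_transSeries_of_ne_zero (hε : ε ≠ 0) (κ : ℕ → K) :
    IsCumulantSystem ε κ (transSeries ε κ) where
  coeff_zero := coeff_zero_transSeries ε κ
  coeff_succ := by
    set M := transSeries ε κ
    set F := risingSeries ε κ 0 with hF
    have hFne : F ≠ 0 := fun h => by
      simpa [← hF, h] using coeff_zero_risingSeries ε κ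
    suffices hshift : mk (fun n => coeff (n + 1) M) = mk fun n => ∑ j ∈ Finset.range (n + 1),
        coeff (n - j) (C (κ (j + 1)) * deformedPow ε M (j + 1)) from fun n => by
      simpa only [coeff_mk, coeff_C_mul] using congrArg (coeff n) hshift
    refine mul_right_cancel₀ hFne (PowerSeries.ext fun n => ?_)
    rw [coeff_mul_eq_sum_range, coeff_mk_sum_mul]
    simp only [coeff_mk, mul_assoc, coeff_C_mul, M, F, ← risingSeries_eq hε κ]
    rw [← coeff_succ_risingSeries_newton hε, coeff_succ_risingSeries_cumulant hε]

end Field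

theorem isCumulantSystem_transSeries [Algebra ℚ R] (ε : R) (κ : ℕ → R) :
    IsCumulantSystem ε κ (transSeries ε κ) := by
  -- By naturality it suffices to treat the universal case, where `ε` is a nonzero element of a
  -- field.
  let A := MvPolynomial (Option ℕ) ℚ
  let ι : A →+* FractionRing A := algebraMap A (FractionRing A)
  let f : A →+* R := (MvPolynomial.aeval fun o : Option ℕ => o.elim ε κ).toRingHom
  have hι : Function.Injective ι := IsFractionRing.injective A (FractionRing A)
  have hX : ι (MvPolynomial.X none) ≠ 0 := (map_ne_zero_iff ι hι).2 (MvPolynomial.X_ne_zero none)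
  have huniv : IsCumulantSystem (MvPolynomial.X none : A) (fun n => MvPolynomial.X (some n))
      (transSeries (MvPolynomial.X none) fun n => MvPolynomial.X (some n)) := by
    refine .of_map hι ?_
    rw [← map_transSeries]
    exact isCumulantSystem_transSeries_of_ne_zero hX _
  have hmap := huniv.map f
  rw [← map_transSeries] at hmap
  simpa [f] using hmap

theorem transPoly_zero_succ [Algebra ℚ R] (κ : ℕ → R) (n : ℕ) :
    transPoly 0 κ (n + 1) = n.factorial * ncMoment κ (n + 1) := by
  have huniq := (isCumulantSystem_transSeries 0 κ).unique (isCumulantSystem_ncSeries κ)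
  have hcoeff := congrArg (coeff (n + 1)) huniq
  rw [coeff_succ_transSeries, ncSeries, coeff_mk,
    inv_smul_eq_iff₀ (Nat.cast_ne_zero.2 n.factorial_ne_zero)] at hcoeff
  rw [hcoeff, Algebra.smul_def, map_natCast]

end TransSeries

/-! ### Annular non-crossing permutations and transitive pairs -/

section Annular

open Equiv

variable {R : Type*} [CommRing R] {α β : Type*}

theorem TransitivePair.symm {σ τ : Perm α} (h : TransitivePair σ τ) : TransitivePair τ σ := by
  rw [transitivePair_iff] at h ⊢
  rw [← h, orbitSetoid, orbitSetoid, sup_comm]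

theorem transitivePair_mul_iff {σ τ : Perm α} :
    TransitivePair σ (σ * τ) ↔ TransitivePair σ τ := by
  have hle : orbitSetoid σ (σ * τ) ≤ orbitSetoid σ τ :=
    orbitSetoid_le_iff.2 ⟨orbitSetoid_left σ τ, fun x =>
      Setoid.trans' _ (orbitSetoid_right σ τ x) (orbitSetoid_left σ τ (τ x))⟩
  have hge : orbitSetoid σ τ ≤ orbitSetoid σ (σ * τ) :=
    orbitSetoid_le_iff.2 ⟨orbitSetoid_left _ _, fun x =>
      Setoid.trans' _ (orbitSetoid_right σ (σ * τ) x)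
        (Setoid.symm' _ (orbitSetoid_left σ (σ * τ) (τ x)))⟩
  rw [transitivePair_iff, transitivePair_iff, le_antisymm hle hge]

theorem cycleCount_permCongr [Finite α] (e : α ≃ β) (σ : Perm α) :
    cycleCount (e.permCongr σ) = cycleCount σ := by
  classical
  have := Fintype.ofFinite α
  have := Fintype.ofEquiv α e
  rw [← card_cycleLengths, ← card_cycleLengths, cycleLengths_permCongr]

variable [DecidableEq α] [Fintype α] [DecidableEq β] [Fintype β]

theorem pos_of_mem_cycleLengths {σ : Perm α} {k : ℕ} (hk : k ∈ cycleLengths σ) : 0 < k :=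
  σ.partition.parts_pos hk

open scoped Classical in
/-- The sum of `κ_σ` over the permutations `σ` which, together with `γ`, act transitively and
satisfy `|σ| + |σ⁻¹γ| = |α|`: for `γ = γ_{t,s}` these are the annular non-crossing permutations. -/
noncomputable def annularSum (κ : ℕ → R) (γ : Perm α) : R :=
  ∑ σ : Perm α with TransitivePair σ γ ∧ cycleCount σ + cycleCount (σ⁻¹ * γ) = Fintype.card α,
    cycleWeight κ σ

theorem annularSum_permCongr (κ : ℕ → R) (e : α ≃ β) (γ : Perm α) :
    annularSum κ (e.permCongr γ) = annularSum κ γ := by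
  classical
  symm
  refine Finset.sum_equiv e.permCongr (fun σ => ?_) fun σ _ => (cycleWeight_permCongr κ e σ).symm
  have hmul : (e.permCongr σ)⁻¹ * e.permCongr γ = e.permCongr (σ⁻¹ * γ) := by
    rw [← permCongrHom_coe, ← map_inv, ← map_mul]
  simp only [Finset.mem_filter, Finset.mem_univ, true_and, transitivePair_permCongr, hmul,
    cycleCount_permCongr, Fintype.card_congr e]

theorem isConj_iff_cycleLengths_eq {γ γ' : Perm α} :
    IsConj γ γ' ↔ cycleLengths γ = cycleLengths γ' := by
  rw [Perm.partition_eq_of_isConj, Nat.Partition.ext_iff, cycleLengths, cycleLengths]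

theorem annularSum_eq_of_cycleLengths (κ : ℕ → R) {γ : Perm α} {γ' : Perm β}
    (h : cycleLengths γ = cycleLengths γ') : annularSum κ γ = annularSum κ γ' := by
  have hcard : Fintype.card α = Fintype.card β := by
    rw [← sum_cycleLengths γ, h, sum_cycleLengths]
  let e : α ≃ β := Fintype.equivOfCardEq hcard
  obtain ⟨g, hg⟩ := isConj_iff.1
    (isConj_iff_cycleLengths_eq.2 ((cycleLengths_permCongr e γ).trans h))
  rw [← hg, ← permCongr_eq_mul, annularSum_permCongr, annularSum_permCongr]

open scoped Classical in
theorem sum_transitivePair_eq_sum_annularSum [Nonempty α] (κ : ℕ → R) :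
    ∑ p : Perm α × Perm α with
        TransitivePair p.1 p.2 ∧ cycleCount p.1 + cycleCount p.2 = Fintype.card α,
      cycleWeight κ p.1
      = ∑ γ : Perm α with cycleCount γ = 2, annularSum κ γ := by
  simp only [annularSum]
  rw [Finset.sum_sigma']
  refine Finset.sum_bij' (fun p _ => ⟨p.1 * p.2, p.1⟩) (fun q _ => (q.2, q.2⁻¹ * q.1))
    ?_ ?_ (fun p _ => by simp) (fun q _ => by simp) fun _ _ => rfl
  · rintro ⟨σ, τ⟩ h
    simp only [Finset.mem_filter, Finset.mem_univ, true_and, Finset.mem_sigma,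
      inv_mul_cancel_left, transitivePair_mul_iff] at h ⊢
    obtain ⟨htrans, hcount⟩ := h
    have hgenus := htrans.symm.genus_le
    have heven := even_cycleCount τ σ
    have hpos := cycleCount_pos (σ * τ)
    rw [Nat.even_iff] at heven
    exact ⟨by omega, htrans, hcount⟩
  · rintro ⟨γ, σ⟩ h
    simp only [Finset.mem_filter, Finset.mem_univ, true_and, Finset.mem_sigma] at h ⊢
    refine ⟨?_, h.2.2⟩
    rw [← transitivePair_mul_iff, mul_inv_cancel_left]
    exact h.2.1

theorem cycleLengths_finRotate {t : ℕ} (ht : 1 ≤ t) : cycleLengths (finRotate t) = {t} := by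
  rw [cycleLengths_eq, ← Perm.sum_cycleType]
  rcases ht.eq_or_lt with rfl | ht
  · simp [Subsingleton.elim (finRotate 1) 1]
  · simp [cycleType_finRotate_of_le ht]

theorem cycleLengths_annularGamma {t s : ℕ} (ht : 1 ≤ t) (hs : 1 ≤ s) :
    cycleLengths (annularGamma t s) = {t, s} := by
  rw [annularGamma, cycleLengths_permCongr, cycleLengths_sumCongr, cycleLengths_finRotate ht,
    cycleLengths_finRotate hs, Multiset.singleton_add, Multiset.insert_eq_cons]

theorem annularSum_annularGamma (κ : ℕ → ℝ) (t s : ℕ) :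
    annularSum κ (annularGamma t s) = ∑ σ ∈ annularNC t s, cycleProd κ σ := by
  have hnum : ∀ σ : Perm (Fin (t + s)), cycleCount σ = numCycles σ :=
    fun σ => (card_cycleLengths σ).symm
  classical
  rw [annularSum, annularNC]
  refine Finset.sum_congr (Finset.filter_congr fun σ _ => ?_) fun σ _ => rfl
  rw [IsAnnularNonCrossing, hnum, hnum, Fintype.card_fin, TransitivePair]

theorem pair_eq_pair_iff {a b c d : ℕ} :
    ({a, b} : Multiset ℕ) = {c, d} ↔ a = c ∧ b = d ∨ a = d ∧ b = c := by
  constructor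
  · intro h
    simp only [Multiset.insert_eq_cons, Multiset.cons_eq_cons, Multiset.singleton_inj,
      Multiset.singleton_eq_cons_iff] at h
    obtain ⟨rfl, rfl⟩ | ⟨-, m, ⟨rfl, rfl⟩, rfl, -⟩ := h
    · exact .inl ⟨rfl, rfl⟩
    · exact .inr ⟨rfl, rfl⟩
  · rintro (⟨rfl, rfl⟩ | ⟨rfl, rfl⟩)
    · rfl
    · exact Multiset.pair_comm _ _

theorem centralizer_factor_pair {t s : ℕ} (ht : 1 ≤ t) (hs : 1 ≤ s) {m : Multiset ℕ}
    (hm : m = Multiset.filter (2 ≤ ·) {t, s}) :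
    (t + s - m.sum).factorial * m.prod * ∏ k ∈ m.toFinset, (m.count k).factorial
      = (if t = s then 2 else 1) * (t * s) := by
  rw [Multiset.insert_eq_cons] at hm
  have htwo : ∀ {k : ℕ}, 1 ≤ k → k = 1 ∨ 2 ≤ k := by omega
  rcases htwo ht with rfl | ht <;> rcases htwo hs with rfl | hs
  · subst hm
    decide
  · rw [Multiset.filter_cons_of_neg _ (by decide), Multiset.filter_singleton, if_pos hs] at hm
    simp [hm, Nat.ne_of_lt hs]
  · rw [Multiset.filter_cons_of_pos _ ht, Multiset.filter_singleton, if_neg (by decide)] at hm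
    simp [hm, Nat.ne_of_gt ht]
  · rw [Multiset.filter_cons_of_pos _ ht, Multiset.filter_singleton, if_pos hs] at hm
    by_cases hts : t = s
    · subst hts
      simp [hm]
      ring
    · rw [hm, Multiset.toFinset_cons, Multiset.toFinset_singleton,
        Finset.prod_insert (by simpa using hts)]
      simp [hts, Ne.symm hts]

theorem card_filter_cycleLengths_eq_pair {γ : Perm α} {t s : ℕ} (hγ : cycleLengths γ = {t, s}) :
    (Finset.univ.filter fun γ' : Perm α => cycleLengths γ' = {t, s}).card
      * ((if t = s then 2 else 1) * (t * s)) = (Fintype.card α).factorial := by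
  have hpos : ∀ k ∈ ({t, s} : Multiset ℕ), 1 ≤ k :=
    fun k hk => pos_of_mem_cycleLengths (by rwa [hγ])
  have hsum : t + s = Fintype.card α := by simpa [hγ] using sum_cycleLengths γ
  have hct : γ.cycleType = Multiset.filter (2 ≤ ·) {t, s} :=
    hγ ▸ Perm.filter_parts_partition_eq_cycleType.symm
  have hconj : Nat.card {γ' : Perm α | IsConj γ γ'}
      = (Finset.univ.filter fun γ' : Perm α => cycleLengths γ' = {t, s}).card := by
    rw [Nat.card_eq_card_toFinset]
    congr 1
    ext γ'
    rw [Set.mem_toFinset, Set.mem_ofPred_eq, isConj_iff_cycleLengths_eq, hγ, eq_comm,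
      Finset.mem_filter_univ]
  rw [← centralizer_factor_pair (hpos t (by simp)) (hpos s (by simp)) hct, hsum, ← hconj,
    Perm.card_isConj_mul_eq]

section ClassFunction

variable {K : Type*} [Field K] [CharZero K]

theorem sum_pairs_cycleLengths (γ : Perm α) :
    ∑ ts ∈ (Finset.HasAntidiagonal.antidiagonal (Fintype.card α)).filter
        (fun ts : ℕ × ℕ => 1 ≤ ts.1 ∧ 1 ≤ ts.2) with cycleLengths γ = {ts.1, ts.2},
      (if ts.1 = ts.2 then 1 else 1 / 2 : K) = if cycleCount γ = 2 then 1 else 0 := by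
  split_ifs with hγ
  · rw [← card_cycleLengths, Multiset.card_eq_two] at hγ
    obtain ⟨a, b, hab⟩ := hγ
    have hpos : ∀ k ∈ ({a, b} : Multiset ℕ), 1 ≤ k :=
      fun k hk => pos_of_mem_cycleLengths (by rwa [hab])
    have hsum : a + b = Fintype.card α := by simpa [hab] using sum_cycleLengths γ
    have hfilter : ((Finset.HasAntidiagonal.antidiagonal (Fintype.card α)).filter
        (fun ts : ℕ × ℕ => 1 ≤ ts.1 ∧ 1 ≤ ts.2)).filter (fun ts => cycleLengths γ = {ts.1, ts.2})
          = {(a, b), (b, a)} := by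
      have ha := hpos a (by simp)
      have hb := hpos b (by simp)
      ext ⟨t, s⟩
      simp only [Finset.mem_filter, Finset.HasAntidiagonal.mem_antidiagonal, hab,
        pair_eq_pair_iff, Finset.mem_insert, Finset.mem_singleton, Prod.mk.injEq]
      omega
    rw [hfilter]
    by_cases h : a = b
    · simp [h]
    · rw [Finset.sum_pair (by simp [h]), if_neg h, if_neg (Ne.symm h), add_halves]
  · refine Finset.sum_eq_zero fun ts hts => absurd ?_ hγ
    rw [← card_cycleLengths, (Finset.mem_filter.1 hts).2, Multiset.card_pair]

theorem sum_cycleCount_eq_two (n : ℕ) (f : Perm (Fin n) → K) (F : ℕ → ℕ → K)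
    (hF : ∀ γ t s, cycleLengths γ = {t, s} → f γ = F t s) :
    ∑ γ : Perm (Fin n) with cycleCount γ = 2, f γ
      = (n.factorial : K) / 2 * ∑ ts ∈ (Finset.HasAntidiagonal.antidiagonal n).filter
        (fun ts => 1 ≤ ts.1 ∧ 1 ≤ ts.2), F ts.1 ts.2 / (ts.1 * ts.2) := by
  have hterm : ∀ ts ∈ (Finset.HasAntidiagonal.antidiagonal n).filter
      (fun ts => 1 ≤ ts.1 ∧ 1 ≤ ts.2), (n.factorial : K) / 2 * (F ts.1 ts.2 / (ts.1 * ts.2))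
      = ∑ γ : Perm (Fin n) with cycleLengths γ = {ts.1, ts.2},
        (if ts.1 = ts.2 then 1 else 1 / 2) * f γ := by
    rintro ⟨t, s⟩ hts
    obtain ⟨hsum, ht, hs⟩ : t + s = n ∧ 1 ≤ t ∧ 1 ≤ s := by simpa using hts
    subst hsum
    have hcard := card_filter_cycleLengths_eq_pair (cycleLengths_annularGamma ht hs)
    rw [Fintype.card_fin] at hcard
    rw [Finset.sum_congr rfl fun γ hγ => by rw [hF γ t s (Finset.mem_filter.1 hγ).2],
      Finset.sum_const, nsmul_eq_mul, ← hcard]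
    have ht : (t : K) ≠ 0 := Nat.cast_ne_zero.2 (by omega)
    have hs : (s : K) ≠ 0 := Nat.cast_ne_zero.2 (by omega)
    push_cast
    split_ifs <;> field_simp
  rw [Finset.mul_sum, Finset.sum_congr rfl hterm]
  simp only [Finset.sum_filter (s := (Finset.univ : Finset (Perm (Fin n))))]
  rw [Finset.sum_comm]
  refine Finset.sum_congr rfl fun γ _ => ?_
  have hweight := sum_pairs_cycleLengths (K := K) γ
  rw [Fintype.card_fin] at hweight
  rw [← Finset.sum_filter, ← Finset.sum_mul, hweight, ite_mul, one_mul, zero_mul]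

end ClassFunction

/-- The annular sum of which `h_n` is the case `κ = r(μ)`. -/
noncomputable def annularCoeff (κ : ℕ → ℝ) (n : ℕ) : ℝ :=
  (n : ℝ) / 2 * ∑ ts ∈ (Finset.HasAntidiagonal.antidiagonal n).filter
      (fun ts => 1 ≤ ts.1 ∧ 1 ≤ ts.2),
    ∑ σ ∈ annularNC ts.1 ts.2, cycleProd κ σ / ((ts.1 : ℝ) * (ts.2 : ℝ))

theorem annularCoeff_congr {κ κ' : ℕ → ℝ} (h : ∀ j, 1 ≤ j → κ j = κ' j) (n : ℕ) :
    annularCoeff κ n = annularCoeff κ' n := by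
  have hprod : ∀ {m : ℕ} (σ : Perm (Fin m)), cycleProd κ σ = cycleProd κ' σ := fun σ =>
    congrArg Multiset.prod (Multiset.map_congr rfl fun _ hx => h _ (σ.partition.parts_pos hx))
  simp only [annularCoeff, hprod]

open scoped Classical in
theorem sum_transitivePair_eq_annularCoeff (κ : ℕ → ℝ) (n : ℕ) :
    ∑ p : Perm (Fin (n + 1)) × Perm (Fin (n + 1)) with
        TransitivePair p.1 p.2 ∧ cycleCount p.1 + cycleCount p.2 = n + 1, cycleWeight κ p.1
      = n.factorial * annularCoeff κ (n + 1) := by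
  have hpairs := sum_transitivePair_eq_sum_annularSum (α := Fin (n + 1)) κ
  rw [Fintype.card_fin] at hpairs
  rw [hpairs, sum_cycleCount_eq_two (n + 1) _ fun t s => ∑ σ ∈ annularNC t s, cycleProd κ σ]
  · rw [annularCoeff, Nat.factorial_succ]
    simp only [Finset.sum_div]
    push_cast
    ring
  · intro γ t s hγ
    have hpos : ∀ k ∈ ({t, s} : Multiset ℕ), 1 ≤ k :=
    fun k hk => pos_of_mem_cycleLengths (by rwa [hγ])
    rw [← annularSum_annularGamma]
    exact annularSum_eq_of_cycleLengths κ (hγ.trans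
      (cycleLengths_annularGamma (hpos t (by simp)) (hpos s (by simp))).symm)

end Annular

/-! ### Root moments and finite free cumulants -/

section SizeDependentCumulants

variable {α β R : Type*} [CommRing R]

theorem partitionCumulant_map (w : Finset β → R) (f : α ↪ β) (S : Finset α) :
    partitionCumulant w (S.map f) = partitionCumulant (fun V => w (V.map f)) S := by
  simp only [partitionCumulant, sum_setPartitions_map, Finset.card_map, Finset.prod_map,
    RelEmbedding.coe_toEmbedding, Finset.mapEmbedding_apply]

theorem partitionCumulant_comp_card (a : ℕ → R) (S : Finset α) :
    partitionCumulant (fun V => a V.card) S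
      = partitionCumulant (fun V => a V.card) (Finset.univ : Finset (Fin S.card)) := by
  classical
  let f : Fin S.card ↪ α := S.equivFin.symm.toEmbedding.trans (Function.Embedding.subtype _)
  have hS : Finset.univ.map f = S := by
    rw [← Finset.map_map, Finset.map_univ_equiv, ← Finset.attach_eq_univ, Finset.attach_map_val]
  conv_lhs => rw [← hS]
  simp only [partitionCumulant_map, Finset.card_map]

theorem sum_choose_mul_partitionCumulant (a : ℕ → R) (ha : a 0 = 1) (n : ℕ) :
    ∑ j ∈ Finset.range (n + 1), n.choose j
        * (partitionCumulant (fun V => a V.card) (Finset.univ : Finset (Fin (j + 1))) * a (n - j))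
      = a (n + 1) := by
  have hrec := sum_partitionCumulant_mul (fun V : Finset ℕ => a V.card) (by simpa using ha)
    (Finset.notMem_range_self (n := n))
  have hterm : ∀ T ∈ (Finset.range n).powerset,
      partitionCumulant (fun V => a V.card) (insert n T) * a (Finset.range n \ T).card
        = partitionCumulant (fun V => a V.card) (Finset.univ : Finset (Fin (T.card + 1)))
          * a (n - T.card) := by
    intro T hT
    rw [Finset.mem_powerset] at hT
    rw [partitionCumulant_comp_card a, Finset.card_sdiff_of_subset hT, Finset.card_range,
      Finset.card_insert_of_notMem fun h => Finset.notMem_range_self (hT h)]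
  rw [Finset.sum_congr rfl hterm, Finset.sum_powerset_apply_card fun j =>
    partitionCumulant (fun V => a V.card) (Finset.univ : Finset (Fin (j + 1))) * a (n - j),
    ← Finset.range_add_one, Finset.card_range, Finset.card_range] at hrec
  simpa only [nsmul_eq_mul] using hrec

end SizeDependentCumulants

theorem finiteFreeCumulant_succ (p : Polynomial ℝ) (n : ℕ) :
    finiteFreeCumulant p (n + 1) = (-(p.natDegree : ℝ)) ^ n / n.factorial *
      partitionCumulant (fun V => normCoeff p V.card) (Finset.univ : Finset (Fin (n + 1))) := by
  rw [finiteFreeCumulant, sum_finpartition fun P => (-1) ^ (P.card - 1) *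
    ((P.card - 1).factorial : ℝ) * ∏ V ∈ P, normCoeff p V.card]
  rfl

theorem permSum_finiteFreeCumulant {p : Polynomial ℝ} (hp : p.Monic) (n : ℕ) :
    permSum (fun k => -(p.natDegree : ℝ) * finiteFreeCumulant p k) n
      = (-(p.natDegree : ℝ)) ^ n * normCoeff p n := by
  have hzero : normCoeff p 0 = 1 := by simp [normCoeff, hp.coeff_natDegree]
  induction n using Nat.strong_induction_on with
  | _ n ih =>
    cases n with
    | zero => simp [permSum_zero, hzero]
    | succ n =>
      rw [permSum_succ, ← sum_choose_mul_partitionCumulant _ hzero, Finset.mul_sum]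
      refine Finset.sum_congr rfl fun j hj => ?_
      obtain ⟨i, rfl⟩ := Nat.exists_eq_add_of_le (Finset.mem_range_succ_iff.1 hj)
      rw [Nat.add_sub_cancel_left, ih i (by omega), finiteFreeCumulant_succ,
        Nat.descFactorial_eq_factorial_mul_choose]
      push_cast
      field_simp
      ring

theorem neg_pow_mul_prod_one_add {d : ℕ} (hd : d ≠ 0) (k : ℕ) :
    (-(d : ℝ)) ^ k * ∏ i ∈ Finset.range k, (1 + (-(d : ℝ))⁻¹ * i)
      = (-1) ^ k * d.descFactorial k := by
  have hd : (d : ℝ) ≠ 0 := Nat.cast_ne_zero.2 hd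
  induction k with
  | zero => simp
  | succ k ih =>
    have hstep : -(d : ℝ) * (1 + (-(d : ℝ))⁻¹ * k) * d.descFactorial k
        = -(((d - k : ℕ) : ℝ) * d.descFactorial k) := by
      rcases Nat.lt_or_ge d k with h | h
      · simp [Nat.descFactorial_eq_zero_iff_lt.2 h]
      · rw [Nat.cast_sub h]
        field_simp
        ring
    rw [Finset.prod_range_succ, pow_succ, mul_mul_mul_comm, ih, Nat.descFactorial_succ]
    push_cast
    linear_combination (-1) ^ k * hstep

theorem coeff_risingSeries_finiteFreeCumulant {d : ℕ} {p : Polynomial ℝ}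
    (hp : IsMonicRealRooted d p) (hd : d ≠ 0) {k : ℕ} (hk : k ≤ d) :
    PowerSeries.coeff k (risingSeries (-(d : ℝ))⁻¹ (finiteFreeCumulant p) 0)
      = p.coeff (d - k) := by
  obtain ⟨hmonic, hdeg, -⟩ := hp
  have hperm := permSum_finiteFreeCumulant hmonic k
  rw [hdeg] at hperm
  have hchoose : (d.choose k : ℝ) ≠ 0 := Nat.cast_ne_zero.2 (Nat.choose_pos hk).ne'
  have hsign : (-1 : ℝ) ^ k * (-1) ^ k = 1 := by rw [← mul_pow]; simp
  rw [coeff_risingSeries, add_zero, inv_inv, hperm, mul_left_comm, ← mul_assoc,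
    neg_pow_mul_prod_one_add hd, normCoeff, hdeg, Nat.descFactorial_eq_factorial_mul_choose]
  push_cast
  field_simp
  linear_combination p.coeff (d - k) * hsign

theorem mul_neg_one_pow_esymm_succ {R : Type*} [CommRing R] (s : Multiset R) (n : ℕ) :
    (n + 1) * ((-1) ^ (n + 1) * s.esymm (n + 1))
      = -∑ j ∈ Finset.range (n + 1), (s.map (· ^ (j + 1))).sum
        * ((-1) ^ (n - j) * s.esymm (n - j)) := by
  classical
  have hnewton := congrArg (MvPolynomial.aeval fun x : s => (x : R))
    (MvPolynomial.mul_esymm_eq_sum s R (n + 1))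
  have hpsum : ∀ k, MvPolynomial.aeval (fun x : s => (x : R)) (MvPolynomial.psum s R k)
      = (s.map (· ^ k)).sum := by
    intro k
    rw [MvPolynomial.psum, map_sum, ← Multiset.map_univ_comp_coe s (· ^ k)]
    simp only [map_pow, MvPolynomial.aeval_X]
    rfl
  simp only [map_mul, map_natCast, map_pow, map_neg, map_one, map_sum,
    MvPolynomial.aeval_esymm_eq_multiset_esymm, Multiset.map_univ_coe, hpsum] at hnewton
  rw [Finset.sum_filter, Finset.Nat.sum_antidiagonal_eq_sum_range_succ (fun i j =>
    if i < n + 1 then (-1) ^ i * s.esymm i * (s.map (· ^ j)).sum else 0),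
    Finset.sum_range_succ, if_neg (lt_irrefl _), add_zero, ← Finset.sum_range_reflect] at hnewton
  have hsign : (-1 : R) ^ (n + 1) * (-1) ^ (n + 1 + 1) = -1 := by
    rw [pow_succ _ (n + 1), ← mul_assoc, ← mul_pow]
    simp
  rw [mul_left_comm, ← Nat.cast_add_one, hnewton, ← mul_assoc, hsign, neg_one_mul]
  congr 1
  refine Finset.sum_congr rfl fun j hj => ?_
  have := Finset.mem_range.1 hj
  rw [if_pos (by omega), show n + 1 - 1 - j = n - j by omega,
    show n + 1 - (n - j) = j + 1 by omega]
  ring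

theorem IsMonicRealRooted.newton {d : ℕ} {p : Polynomial ℝ} (hp : IsMonicRealRooted d p) {n : ℕ}
    (hn : n + 1 ≤ d) :
    (n + 1) * p.coeff (d - (n + 1))
      = -(d : ℝ) * ∑ j ∈ Finset.range (n + 1), rootMoment p (j + 1) * p.coeff (d - (n - j)) := by
  obtain ⟨hmonic, hdeg, hsplits⟩ := hp
  have hd : (d : ℝ) ≠ 0 := Nat.cast_ne_zero.2 (by omega)
  have hcoeff : ∀ k ≤ d, p.coeff (d - k) = (-1) ^ k * p.roots.esymm k := by
    intro k hk
    rw [Polynomial.coeff_eq_esymm_roots_of_card hsplits.natDegree_eq_card_roots.symm (by omega),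
      hmonic.leadingCoeff, one_mul, hdeg, Nat.sub_sub_self hk]
  rw [hcoeff _ hn, mul_neg_one_pow_esymm_succ, neg_mul, Finset.mul_sum]
  congr 1
  refine Finset.sum_congr rfl fun j _ => ?_
  rw [hcoeff _ (by omega), rootMoment, hdeg]
  field_simp

theorem rootMoment_eq_coeff_transSeries {d : ℕ} {p : Polynomial ℝ} (hp : IsMonicRealRooted d p)
    {n : ℕ} (hn : n + 1 ≤ d) :
    rootMoment p (n + 1)
      = PowerSeries.coeff (n + 1) (transSeries (-(d : ℝ))⁻¹ (finiteFreeCumulant p)) := by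
  have hd : d ≠ 0 := by omega
  have hneg : -(d : ℝ) ≠ 0 := neg_ne_zero.2 (Nat.cast_ne_zero.2 hd)
  induction n using Nat.strong_induction_on with
  | _ n ih =>
    have hnewton := coeff_succ_risingSeries_newton (inv_ne_zero hneg) (finiteFreeCumulant p) n
    rw [coeff_risingSeries_finiteFreeCumulant hp hd hn, hp.newton hn,
      inv_mul_cancel_left₀ hneg, Finset.sum_range_succ, Finset.sum_range_succ,
      Nat.sub_self, coeff_zero_risingSeries, Nat.sub_zero, ← hp.2.1, hp.1.coeff_natDegree,
      hp.2.1] at hnewton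
    have hlower : ∀ j ∈ Finset.range n, rootMoment p (j + 1) * p.coeff (d - (n - j))
        = PowerSeries.coeff (j + 1) (transSeries (-(d : ℝ))⁻¹ (finiteFreeCumulant p))
          * PowerSeries.coeff (n - j) (risingSeries (-(d : ℝ))⁻¹ (finiteFreeCumulant p) 0) := by
      intro j hj
      have := Finset.mem_range.1 hj
      rw [ih j this (by omega), coeff_risingSeries_finiteFreeCumulant hp hd (by omega)]
    rw [Finset.sum_congr rfl hlower, mul_one, mul_one] at hnewton
    exact add_left_cancel hnewton

/-! ### Power series over the dual numbers -/

section DualSeries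

open PowerSeries

variable {R : Type*} [CommRing R]

theorem coeff_pow_of_lt {g : R⟦X⟧} (hg : constantCoeff g = 0) {n k : ℕ} (h : n < k) :
    coeff n (g ^ k) = 0 :=
  X_pow_dvd_iff.1 (pow_dvd_pow_of_dvd (X_dvd_iff.2 hg) k) n h

theorem coeff_subst_eq_sum_range {g : R⟦X⟧} (hg : constantCoeff g = 0) (f : R⟦X⟧) {n N : ℕ}
    (h : n < N) :
    coeff n (f.subst g : R⟦X⟧) = ∑ k ∈ Finset.range N, coeff k f * coeff n (g ^ k) := by
  rw [coeff_subst' (HasSubst.of_constantCoeff_zero' hg), finsum_eq_sum_of_support_subset]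
  · rfl
  · intro k hk
    by_contra hlt
    rw [Finset.coe_range, Set.mem_Iio] at hlt
    exact hk (by simp only [coeff_pow_of_lt hg (show n < k by omega), smul_zero])

theorem coeff_subst_mul {g : R⟦X⟧} (hg : constantCoeff g = 0) (f w : R⟦X⟧) {n N : ℕ}
    (h : n < N) :
    coeff n ((f.subst g : R⟦X⟧) * w)
      = ∑ k ∈ Finset.range N, coeff k f * coeff n (g ^ k * w) := by
  simp only [coeff_mul, Finset.mul_sum]
  rw [Finset.sum_comm]
  refine Finset.sum_congr rfl fun p hp => ?_
  have hp := Finset.HasAntidiagonal.mem_antidiagonal.1 hp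
  rw [coeff_subst_eq_sum_range hg f (show p.1 < N by omega), Finset.sum_mul]
  exact Finset.sum_congr rfl fun k _ => by ring

/-- The reduction modulo `ε` of a power series over the dual numbers. -/
noncomputable def fstSeries : (DualNumber R)⟦X⟧ →+* R⟦X⟧ :=
  PowerSeries.map (TrivSqZeroExt.fstHom R R R : DualNumber R →+* R)

/-- The coefficient of `ε` of a power series over the dual numbers. -/
noncomputable def sndSeries : (DualNumber R)⟦X⟧ →+ R⟦X⟧ where
  toFun f := mk fun n => (coeff n f).snd
  map_zero' := by ext; simp
  map_add' f g := by ext; simp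

theorem coeff_fstSeries (f : (DualNumber R)⟦X⟧) (n : ℕ) :
    coeff n (fstSeries f) = (coeff n f).fst :=
  rfl

theorem coeff_sndSeries (f : (DualNumber R)⟦X⟧) (n : ℕ) :
    coeff n (sndSeries f) = (coeff n f).snd := by
  simp [sndSeries]

theorem fstSeries_X : fstSeries (X : (DualNumber R)⟦X⟧) = X :=
  map_X _

theorem sndSeries_X : sndSeries (X : (DualNumber R)⟦X⟧) = 0 := by
  ext n
  rw [coeff_sndSeries, coeff_X]
  split_ifs <;> simp

theorem sndSeries_one : sndSeries (1 : (DualNumber R)⟦X⟧) = 0 := by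
  ext n
  rw [coeff_sndSeries, coeff_one]
  split_ifs <;> simp

theorem sndSeries_mul (f g : (DualNumber R)⟦X⟧) :
    sndSeries (f * g) = fstSeries f * sndSeries g + sndSeries f * fstSeries g := by
  ext n
  simp only [map_add, coeff_mul, coeff_sndSeries, coeff_fstSeries, TrivSqZeroExt.snd_sum,
    ← Finset.sum_add_distrib]
  exact Finset.sum_congr rfl fun p _ => by simp [mul_comm]

theorem fstSeries_subst {g : (DualNumber R)⟦X⟧} (hg : constantCoeff g = 0)
    (f : (DualNumber R)⟦X⟧) :
    fstSeries (f.subst g) = (fstSeries f).subst (fstSeries g) :=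
  map_subst (HasSubst.of_constantCoeff_zero' hg) f

theorem sndSeries_pow_succ (f : (DualNumber R)⟦X⟧) (k : ℕ) :
    sndSeries (f ^ (k + 1)) = (k + 1) * (fstSeries f ^ k * sndSeries f) := by
  induction k with
  | zero => simp
  | succ k ih =>
    rw [pow_succ, sndSeries_mul, ih, map_pow]
    push_cast
    ring

theorem sndSeries_subst {g : (DualNumber R)⟦X⟧} (hg : constantCoeff g = 0)
    (f : (DualNumber R)⟦X⟧) :
    sndSeries (f.subst g) = (sndSeries f).subst (fstSeries g)
      + (derivative R (fstSeries f)).subst (fstSeries g) * sndSeries g := by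
  have hg₀ : constantCoeff (fstSeries g) = 0 := by
    rw [← coeff_zero_eq_constantCoeff_apply, coeff_fstSeries, coeff_zero_eq_constantCoeff_apply,
      hg, TrivSqZeroExt.fst_zero]
  ext n
  have hterm : ∀ k, (coeff k f * coeff n (g ^ k)).snd
      = coeff k (sndSeries f) * coeff n (fstSeries g ^ k)
        + coeff k (fstSeries f) * coeff n (sndSeries (g ^ k)) := by
    intro k
    rw [← map_pow, coeff_fstSeries, coeff_fstSeries, coeff_sndSeries, coeff_sndSeries]
    simp [mul_comm, add_comm]
  rw [coeff_sndSeries, coeff_subst_eq_sum_range hg f (show n < n + 2 by omega),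
    TrivSqZeroExt.snd_sum, Finset.sum_congr rfl fun k _ => hterm k, Finset.sum_add_distrib, map_add,
    coeff_subst_eq_sum_range hg₀ (sndSeries f) (show n < n + 2 by omega),
    coeff_subst_mul hg₀ _ _ (Nat.lt_succ_self n)]
  congr 1
  rw [Finset.sum_range_succ', pow_zero, sndSeries_one, map_zero, mul_zero, add_zero]
  refine Finset.sum_congr rfl fun k _ => ?_
  rw [sndSeries_pow_succ, coeff_derivative, ← Nat.cast_succ, ← map_natCast (C (R := R)),
    coeff_C_mul]
  push_cast
  ring

end DualSeries

section Derivative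

open PowerSeries

variable {R : Type*} [CommRing R]

theorem ncSeries_eq_one_add (κ : ℕ → R) :
    ncSeries κ = 1 + X * ncSeries κ * ((mk fun j => κ (j + 1)).subst (X * ncSeries κ) : R⟦X⟧) := by
  have hsys := isCumulantSystem_ncSeries κ
  ext n
  cases n with
  | zero => simp [hsys.coeff_zero, mul_assoc]
  | succ n =>
    rw [map_add, coeff_one, if_neg n.succ_ne_zero, zero_add, mul_assoc, coeff_succ_X_mul,
      mul_comm, coeff_subst_mul (by simp) _ _ (Nat.lt_succ_self n), hsys.coeff_succ]
    refine Finset.sum_congr rfl fun j hj => ?_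
    have hj : j ≤ n := Nat.lt_succ_iff.1 (Finset.mem_range.1 hj)
    rw [deformedPow_zero_left, mul_pow, mul_assoc, ← pow_succ, coeff_X_pow_mul', if_pos hj,
      coeff_mk]

theorem fstSeries_ncSeries (κ : ℕ → DualNumber R) :
    fstSeries (ncSeries κ) = ncSeries fun j => (κ j).fst :=
  ((isCumulantSystem_ncSeries κ).map
    (TrivSqZeroExt.fstHom R R R : DualNumber R →+* R)).unique (by
      simpa using isCumulantSystem_ncSeries fun j => (κ j).fst)

theorem isUnit_ncSeries (κ : ℕ → R) : IsUnit (ncSeries κ) := by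
  rw [isUnit_iff_constantCoeff, ← coeff_zero_eq_constantCoeff_apply,
    (isCumulantSystem_ncSeries κ).coeff_zero]
  exact isUnit_one

theorem sndSeries_ncSeries_eq_add (κ : ℕ → DualNumber R) {M G : R⟦X⟧}
    (hM : M = ncSeries fun j => (κ j).fst) (hG : G = X * M) :
    sndSeries (ncSeries κ)
      = G * (((mk fun j => (κ (j + 1)).snd).subst G : R⟦X⟧)
          + (derivative R (mk fun j => (κ (j + 1)).fst)).subst G * (X * sndSeries (ncSeries κ)))
        + X * sndSeries (ncSeries κ) * ((mk fun j => (κ (j + 1)).fst).subst G : R⟦X⟧) := by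
  set K : (DualNumber R)⟦X⟧ := mk fun j => κ (j + 1)
  have hK₀ : fstSeries K = mk fun j => (κ (j + 1)).fst := by ext; simp [coeff_fstSeries, K]
  have hK₁ : sndSeries K = mk fun j => (κ (j + 1)).snd := by ext; simp [coeff_sndSeries, K]
  have hG₀ : fstSeries (X * ncSeries κ) = G := by
    rw [map_mul, fstSeries_X, fstSeries_ncSeries, hG, hM]
  have hG₁ : sndSeries (X * ncSeries κ) = X * sndSeries (ncSeries κ) := by
    rw [sndSeries_mul, fstSeries_X, sndSeries_X, zero_mul, add_zero]
  have hzero : constantCoeff (X * ncSeries κ) = 0 := by simp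
  conv_lhs => rw [ncSeries_eq_one_add, map_add, sndSeries_one, zero_add, sndSeries_mul,
    sndSeries_subst hzero, fstSeries_subst hzero, hG₀, hG₁, hK₀, hK₁]

-- Differentiating `M = 1 + G (K ∘ G)`, `G = x M`, along `ε` and along `x` gives two linear
-- equations with the same factor `1 - x (K ∘ G) - x G (K' ∘ G)`, which is then eliminated.
theorem sndSeries_ncSeries (κ : ℕ → DualNumber R) :
    sndSeries (ncSeries κ) = X
      * ((mk fun n => (κ (n + 1)).snd).subst (X * ncSeries fun j => (κ j).fst) : R⟦X⟧)
      * derivative R (X * ncSeries fun j => (κ j).fst) := by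
  set M : R⟦X⟧ := ncSeries fun j => (κ j).fst with hM
  set M₁ : R⟦X⟧ := sndSeries (ncSeries κ)
  set G : R⟦X⟧ := X * M with hG
  set K : R⟦X⟧ := mk fun j => (κ (j + 1)).fst with hK
  have hM₁ := sndSeries_ncSeries_eq_add κ hM hG
  have hGs : HasSubst G := HasSubst.of_constantCoeff_zero' (by simp [hG])
  have hM' : derivative R M = derivative R G * (K.subst G : R⟦X⟧)
      + G * ((derivative R K).subst G * derivative R G) := by
    conv_lhs => rw [hM, ncSeries_eq_one_add, ← hM, ← hG, ← hK]
    rw [map_add, derivative_one, zero_add, Derivation.leibniz, derivative_subst hGs, smul_eq_mul,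
      smul_eq_mul]
    ring
  have hG' : derivative R G = M + X * derivative R M := by
    rw [hG, Derivation.leibniz, derivative_X, smul_eq_mul, smul_eq_mul, mul_one, add_comm]
  refine (isUnit_ncSeries fun j => (κ j).fst).mul_right_cancel ?_
  rw [← hM]
  linear_combination derivative R G * hM₁ - M₁ * hG' - X * M₁ * hM'
    + derivative R G * ((mk fun n => (κ (n + 1)).snd).subst G : R⟦X⟧) * hG

end Derivative

/-! ### Transitive pairs to first order -/

section FirstOrder

open Equiv PowerSeries

open scoped Classical in
theorem transPoly_of_mul_self_eq_zero {R : Type*} [CommRing R] {e : R} (he : e * e = 0)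
    (κ : ℕ → R) (n : ℕ) :
    transPoly e κ (n + 1) = transPoly 0 κ (n + 1)
      + e * ∑ p : Perm (Fin (n + 1)) × Perm (Fin (n + 1)) with
        TransitivePair p.1 p.2 ∧ cycleCount p.1 + cycleCount p.2 = n + 1, cycleWeight κ p.1 := by
  rw [← Finset.filter_filter, Finset.sum_filter (fun p : Perm (Fin (n + 1)) × Perm (Fin (n + 1)) =>
    cycleCount p.1 + cycleCount p.2 = n + 1), Finset.mul_sum, transPoly, transPoly,
    ← Finset.sum_add_distrib]
  refine Finset.sum_congr rfl fun p hp => ?_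
  have hgenus := (Finset.mem_filter.1 hp).2.cycleCount_add_le
  rw [Fintype.card_fin] at hgenus
  obtain ⟨k, hk⟩ : ∃ k, n + 1 + 1 - (cycleCount p.1 + cycleCount p.2) = k := ⟨_, rfl⟩
  rw [hk]
  match k with
  | 0 => simp [show cycleCount p.1 + cycleCount p.2 ≠ n + 1 by omega]
  | 1 => simp [show cycleCount p.1 + cycleCount p.2 = n + 1 by omega]
  | k + 2 =>
    simp [show cycleCount p.1 + cycleCount p.2 ≠ n + 1 by omega, pow_succ, mul_assoc, he]

theorem coeff_succ_transSeries_neg_eps (κ : ℕ → DualNumber ℝ) (n : ℕ) :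
    coeff (n + 1) (transSeries (-DualNumber.eps) κ)
      = ncMoment κ (n + 1)
        - TrivSqZeroExt.inr (annularCoeff (fun j => (κ j).fst) (n + 1)) := by
  classical
  have heps_mul : ∀ w : DualNumber ℝ, -DualNumber.eps * w = -TrivSqZeroExt.inr w.fst := fun w =>
    TrivSqZeroExt.ext (by simp) (by simp)
  have hfst : (∑ p : Perm (Fin (n + 1)) × Perm (Fin (n + 1)) with
        TransitivePair p.1 p.2 ∧ cycleCount p.1 + cycleCount p.2 = n + 1, cycleWeight κ p.1).fst
      = n.factorial * annularCoeff (fun j => (κ j).fst) (n + 1) := by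
    rw [← sum_transitivePair_eq_annularCoeff, TrivSqZeroExt.fst_sum]
    exact Finset.sum_congr rfl fun p _ =>
      (map_cycleWeight (TrivSqZeroExt.fstHom ℝ ℝ ℝ : DualNumber ℝ →+* ℝ) κ p.1).symm
  rw [coeff_succ_transSeries, inv_smul_eq_iff₀ (Nat.cast_ne_zero.2 n.factorial_ne_zero),
    transPoly_of_mul_self_eq_zero (by simp), transPoly_zero_succ, heps_mul, hfst]
  rw [Nat.cast_smul_eq_nsmul, nsmul_eq_mul, mul_sub, ← sub_eq_add_neg]
  congr 1
  refine TrivSqZeroExt.ext ?_ ?_ <;> simp [mul_comm]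

theorem annularCoeff_of_lt_two (κ : ℕ → ℝ) {n : ℕ} (hn : n < 2) : annularCoeff κ n = 0 := by
  rw [annularCoeff, Finset.filter_eq_empty_iff.2, Finset.sum_empty, mul_zero]
  intro ts hts
  have := Finset.HasAntidiagonal.mem_antidiagonal.1 hts
  omega

theorem fstSeries_transSeries_neg_eps (κ : ℕ → DualNumber ℝ) :
    fstSeries (transSeries (-DualNumber.eps) κ) = ncSeries fun j => (κ j).fst := by
  rw [← fstSeries_ncSeries]
  ext n
  cases n with
  | zero => rw [coeff_fstSeries, coeff_fstSeries, coeff_zero_transSeries,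
      (isCumulantSystem_ncSeries κ).coeff_zero]
  | succ n => simp [coeff_fstSeries, coeff_succ_transSeries_neg_eps, ncSeries]

theorem sndSeries_transSeries_neg_eps (κ : ℕ → DualNumber ℝ) :
    sndSeries (transSeries (-DualNumber.eps) κ)
      = sndSeries (ncSeries κ) - mk (annularCoeff fun j => (κ j).fst) := by
  ext n
  rw [map_sub, coeff_sndSeries, coeff_sndSeries, coeff_mk]
  cases n with
  | zero => rw [coeff_zero_transSeries, (isCumulantSystem_ncSeries κ).coeff_zero,
      annularCoeff_of_lt_two _ two_pos, sub_zero]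
  | succ n => simp [coeff_succ_transSeries_neg_eps, ncSeries]

end FirstOrder

/-! ### First-order expansions -/

section Expansion

/-- The first-order expansion `x_d = a + b / d + o(1 / d)`, encoded as the dual number
`z = a + b ε`. -/
def HasExpansion (x : ℕ → ℝ) (z : DualNumber ℝ) : Prop :=
  Tendsto x atTop (𝓝 z.fst) ∧
    Tendsto (fun d : ℕ => (d : ℝ) * (x d - z.fst)) atTop (𝓝 z.snd)

namespace HasExpansion

variable {x y : ℕ → ℝ} {z w : DualNumber ℝ}

theorem congr (h : HasExpansion x z) (hxy : x =ᶠ[atTop] y) : HasExpansion y z :=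
  ⟨h.1.congr' hxy, h.2.congr' (hxy.mono fun d hd => by simp only [hd])⟩

theorem const (a : ℝ) : HasExpansion (fun _ => a) (TrivSqZeroExt.inl a) :=
  ⟨tendsto_const_nhds, by simp⟩

theorem add (hx : HasExpansion x z) (hy : HasExpansion y w) : HasExpansion (x + y) (z + w) := by
  refine ⟨hx.1.add hy.1, (hx.2.add hy.2).congr fun d => ?_⟩
  simp only [TrivSqZeroExt.fst_add, Pi.add_apply]
  ring

theorem neg (hx : HasExpansion x z) : HasExpansion (-x) (-z) := by
  refine ⟨hx.1.neg, hx.2.neg.congr fun d => ?_⟩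
  simp only [TrivSqZeroExt.fst_neg, Pi.neg_apply]
  ring

theorem mul (hx : HasExpansion x z) (hy : HasExpansion y w) : HasExpansion (x * y) (z * w) := by
  refine ⟨hx.1.mul hy.1, ?_⟩
  have hsnd : (z * w).snd = z.snd * w.fst + z.fst * w.snd := by
    rw [DualNumber.snd_mul, add_comm]
  rw [hsnd]
  refine ((hx.2.mul hy.1).add (hy.2.const_mul z.fst)).congr fun d => ?_
  simp only [TrivSqZeroExt.fst_mul, Pi.mul_apply]
  ring

theorem inv (hx : HasExpansion x z) (hz : z.fst ≠ 0) : HasExpansion x⁻¹ z⁻¹ := by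
  have hinv := hx.1.inv₀ hz
  have hsnd : z⁻¹.snd = -z.snd * (z.fst⁻¹ * z.fst⁻¹) := by simp; ring
  refine ⟨hinv, hsnd ▸ (hx.2.neg.mul (hinv.mul_const z.fst⁻¹)).congr' ?_⟩
  filter_upwards [hx.1.eventually_ne hz] with d hd
  simp only [TrivSqZeroExt.fst_inv, Pi.inv_apply]
  field_simp
  ring

theorem unique (h : HasExpansion x z) (h' : HasExpansion x w) : z = w := by
  have hfst : z.fst = w.fst := tendsto_nhds_unique h.1 h'.1
  exact TrivSqZeroExt.ext hfst (tendsto_nhds_unique h.2 (by rw [hfst]; exact h'.2))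

theorem neg_eps : HasExpansion (fun d => (-(d : ℝ))⁻¹) (-DualNumber.eps) := by
  refine ⟨?_, tendsto_const_nhds.congr' ?_⟩
  · simpa [inv_neg] using (tendsto_inv_atTop_nhds_zero_nat (𝕜 := ℝ)).neg
  · filter_upwards [eventually_ne_atTop 0] with d hd
    have : (d : ℝ) ≠ 0 := Nat.cast_ne_zero.2 hd
    simp [inv_neg, this]

theorem isLittleO (hx : HasExpansion x z) :
    (fun d : ℕ => x d - z.fst - (1 / (d : ℝ)) * z.snd) =o[atTop] fun d : ℕ => 1 / (d : ℝ) := by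
  have hne : ∀ᶠ d : ℕ in atTop, (d : ℝ) ≠ 0 :=
    (eventually_ne_atTop 0).mono fun d => Nat.cast_ne_zero.2
  rw [isLittleO_iff_tendsto' (hne.mono fun d hd h0 => absurd h0 (one_div_ne_zero hd))]
  have hlim := hx.2.sub_const z.snd
  rw [sub_self] at hlim
  refine hlim.congr' (hne.mono fun d hd => ?_)
  field_simp

end HasExpansion

/-- The ring of germs at infinity of sequences with a first-order expansion, each paired with its
expansion. -/
def expansionRing : Subring (Germ (atTop : Filter ℕ) ℝ × DualNumber ℝ) where
  carrier := {q | ∃ x : ℕ → ℝ, ↑x = q.1 ∧ HasExpansion x q.2}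
  mul_mem' := by
    rintro ⟨_, z⟩ ⟨_, w⟩ ⟨x, rfl, hx⟩ ⟨y, rfl, hy⟩
    exact ⟨x * y, rfl, hx.mul hy⟩
  one_mem' := ⟨1, rfl, HasExpansion.const 1⟩
  add_mem' := by
    rintro ⟨_, z⟩ ⟨_, w⟩ ⟨x, rfl, hx⟩ ⟨y, rfl, hy⟩
    exact ⟨x + y, rfl, hx.add hy⟩
  zero_mem' := ⟨0, rfl, HasExpansion.const 0⟩
  neg_mem' := by
    rintro ⟨_, z⟩ ⟨x, rfl, hx⟩
    exact ⟨-x, rfl, hx.neg⟩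

theorem HasExpansion.mem_expansionRing {x : ℕ → ℝ} {z : DualNumber ℝ} (h : HasExpansion x z) :
    ((x : Germ (atTop : Filter ℕ) ℝ), z) ∈ expansionRing :=
  ⟨x, rfl, h⟩

theorem hasExpansion_of_mem_expansionRing {x : ℕ → ℝ} {z : DualNumber ℝ}
    (h : ((x : Germ (atTop : Filter ℕ) ℝ), z) ∈ expansionRing) : HasExpansion x z := by
  obtain ⟨y, hyx, hy⟩ := h
  exact hy.congr (Germ.coe_eq.1 hyx)

theorem isUnit_expansionRing (a : expansionRing) (ha : a.1.2.fst ≠ 0) : IsUnit a := by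
  obtain ⟨x, hxa, hx⟩ := a.2
  refine IsUnit.of_mul_eq_one ⟨_, (hx.inv ha).mem_expansionRing⟩ (Subtype.ext (Prod.ext ?_ ?_))
  · change a.1.1 * _ = 1
    rw [← hxa]
    exact Germ.coe_eq.2 ((hx.1.eventually_ne ha).mono fun d hd => mul_inv_cancel₀ hd)
  · exact TrivSqZeroExt.mul_inv_cancel ha

end Expansion

/-! ### Expansion of the finite-free cumulants -/

section InfinitesimalDistribution

open PowerSeries

variable {p : ℕ → Polynomial ℝ} {μ : Measure ℝ} {μ' : Polynomial ℝ →ₗ[ℝ] ℝ}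

theorem rootMoment_zero {q : Polynomial ℝ} {d : ℕ} (hq : IsMonicRealRooted d q) (hd : d ≠ 0) :
    rootMoment q 0 = 1 := by
  obtain ⟨-, rfl, hs⟩ := hq
  simp [rootMoment, ← hs.natDegree_eq_card_roots, hd]

theorem eventually_isMonicRealRooted (h : HasInfinitesimalDistribution p μ μ') (n : ℕ) :
    ∀ᶠ d in atTop, n + 1 ≤ d ∧ IsMonicRealRooted d (p d) :=
  (eventually_ge_atTop (n + 1)).mono fun d hd => ⟨hd, h.realRooted d (by omega)⟩

/-- The series `∑ (m_n(μ) + μ'(x^n) ε) x^n`, whose coefficients are the first-order expansions of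
the moments of a sequence with infinitesimal distribution `(μ, μ')`. -/
noncomputable def momentExpansion (μ : Measure ℝ) (μ' : Polynomial ℝ →ₗ[ℝ] ℝ) :
    (DualNumber ℝ)⟦X⟧ :=
  mk fun n => TrivSqZeroExt.inl (measMoment μ n) + TrivSqZeroExt.inr (μ' (Polynomial.X ^ n))

theorem fst_coeff_momentExpansion (n : ℕ) :
    (coeff n (momentExpansion μ μ')).fst = measMoment μ n := by
  simp [momentExpansion]

theorem snd_coeff_momentExpansion (n : ℕ) :
    (coeff n (momentExpansion μ μ')).snd = μ' (Polynomial.X ^ n) := by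
  simp [momentExpansion]

theorem hasExpansion_rootMoment (h : HasInfinitesimalDistribution p μ μ') (n : ℕ) :
    HasExpansion (fun d => rootMoment (p d) n) (coeff n (momentExpansion μ μ')) := by
  rw [HasExpansion, fst_coeff_momentExpansion, snd_coeff_momentExpansion]
  exact ⟨h.tendsto_moment n, h.tendsto_infinitesimal n⟩

theorem coeff_zero_momentExpansion (h : HasInfinitesimalDistribution p μ μ') :
    coeff 0 (momentExpansion μ μ') = 1 :=
  (hasExpansion_rootMoment h 0).unique <| (HasExpansion.const 1).congr <|
    (eventually_isMonicRealRooted h 0).mono fun _ hd =>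
      (rootMoment_zero hd.2 (Nat.one_le_iff_ne_zero.1 hd.1)).symm

theorem rootMoment_eventuallyEq_coeff_transSeries (h : HasInfinitesimalDistribution p μ μ')
    (n : ℕ) : (fun d => rootMoment (p d) n) =ᶠ[atTop] coeff n
      (transSeries (fun d : ℕ => (-(d : ℝ))⁻¹) fun n d => finiteFreeCumulant (p d) n) := by
  cases n with
  | zero =>
    rw [coeff_zero_transSeries]
    exact (eventually_isMonicRealRooted h 0).mono fun _ hd =>
      rootMoment_zero hd.2 (Nat.one_le_iff_ne_zero.1 hd.1)
  | succ n =>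
    refine (eventually_isMonicRealRooted h n).mono fun d hd => ?_
    have heval := map_transSeries (Pi.evalRingHom (fun _ : ℕ => ℝ) d)
      (fun d : ℕ => (-(d : ℝ))⁻¹) fun n d => finiteFreeCumulant (p d) n
    exact (rootMoment_eq_coeff_transSeries hd.2 hd.1).trans (congrArg (coeff (n + 1)) heval)

theorem isCumulantSystem_germ (h : HasInfinitesimalDistribution p μ μ') :
    IsCumulantSystem (Germ.ofFun fun d : ℕ => (-(d : ℝ))⁻¹ : Germ atTop ℝ)
      (fun n => Germ.ofFun fun d => finiteFreeCumulant (p d) n)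
      (mk fun n => Germ.ofFun fun d => rootMoment (p d) n) := by
  have hM : (mk fun n => Germ.ofFun fun d => rootMoment (p d) n) =
      (transSeries (fun d : ℕ => (-(d : ℝ))⁻¹) fun n d => finiteFreeCumulant (p d) n).map
        (Germ.coeRingHom atTop) := PowerSeries.ext fun n => by
    rw [coeff_mk, coeff_map]
    exact Germ.coe_eq.2 (rootMoment_eventuallyEq_coeff_transSeries h n)
  rw [hM]
  exact (isCumulantSystem_transSeries (fun d : ℕ => (-(d : ℝ))⁻¹) _).map (Germ.coeRingHom atTop)

theorem exists_hasExpansion_finiteFreeCumulant (h : HasInfinitesimalDistribution p μ μ') :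
    ∃ κ : ℕ → DualNumber ℝ,
      (∀ n, HasExpansion (fun d => finiteFreeCumulant (p d) (n + 1)) (κ (n + 1))) ∧
        transSeries (-DualNumber.eps) κ = momentExpansion μ μ' := by
  let ε : expansionRing := ⟨_, HasExpansion.neg_eps.mem_expansionRing⟩
  let M : expansionRing⟦X⟧ := mk fun n => ⟨_, (hasExpansion_rootMoment h n).mem_expansionRing⟩
  have hunit (i : ℕ) : IsUnit (1 + ε * i) := isUnit_expansionRing _ (by simp [ε])
  have hM : coeff 0 M = 1 := by
    rw [coeff_mk]
    refine Subtype.ext (Prod.ext ?_ (coeff_zero_momentExpansion h))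
    simpa using (isCumulantSystem_germ h).coeff_zero
  have hsystem := isCumulantSystem_cumulantSeq hunit hM
  let toGerm := (RingHom.fst _ _).comp expansionRing.subtype
  let toDual := (RingHom.snd _ _).comp expansionRing.subtype
  refine ⟨fun n => toDual (cumulantSeq ε M n), fun n => ?_, ?_⟩
  · have hgerm : toGerm (cumulantSeq ε M (n + 1)) = _ :=
      (hsystem.map toGerm).cumulant_unique
        (fun i => by simpa using (hunit i).map toGerm) (isCumulantSystem_germ h) n
    apply hasExpansion_of_mem_expansionRing
    rw [← hgerm]
    exact (cumulantSeq ε M (n + 1)).2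
  · have hdual : M.map toDual = momentExpansion μ μ' :=
      PowerSeries.ext fun n => by rw [coeff_map, coeff_mk]; rfl
    exact hdual ▸ (isCumulantSystem_transSeries _ _).unique (hsystem.map toDual)

end InfinitesimalDistribution

/-! ### The infinitesimal Cauchy transform -/

section InfinitesimalCauchyTransform

open PowerSeries

theorem isNonCrossing_iff {n : ℕ} (π : SetPartition n) :
    IsNonCrossing π ↔ NonCrossing π.parts :=
  ⟨fun h V hV W hW a ha b hb c hc d hd hab hbc hcd =>
      h a b c d hab hbc hcd V hV W hW ha hc hb hd,
    fun h a b c d hab hbc hcd V hV W hW ha hc hb hd =>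
      h V hV W hW a ha b hb c hc d hd hab hbc hcd⟩

theorem measMoment_eq_ncMoment (μ : Measure ℝ) {n : ℕ} (hn : 1 ≤ n) :
    measMoment μ n = ncMoment (freeCumulant μ) n := by
  classical
  rw [moment_eq_sum_freeCumulantSeq (measMoment μ) n hn, NC, Finset.sum_filter, ncMoment, ncSum,
    Finset.sum_filter, ← sum_finpartition]
  exact Finset.sum_congr rfl fun π _ => if_congr (isNonCrossing_iff π) rfl rfl

theorem mk_measMoment {μ : Measure ℝ} (hμ : measMoment μ 0 = 1) :
    mk (measMoment μ) = ncSeries (freeCumulant μ) := by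
  ext n
  cases n with
  | zero => rw [coeff_mk, hμ, (isCumulantSystem_ncSeries _).coeff_zero]
  | succ n => rw [coeff_mk, measMoment_eq_ncMoment μ n.succ_pos, ncSeries, coeff_mk]

variable {p : ℕ → Polynomial ℝ} {μ : Measure ℝ} {μ' : Polynomial ℝ →ₗ[ℝ] ℝ}
  {κ : ℕ → DualNumber ℝ}

theorem fstSeries_momentExpansion : fstSeries (momentExpansion μ μ') = mk (measMoment μ) := by
  ext n
  rw [coeff_fstSeries, fst_coeff_momentExpansion, coeff_mk]

theorem X_mul_sndSeries_momentExpansion :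
    X * sndSeries (momentExpansion μ μ') = infCauchyTransform μ' := by
  rw [infCauchyTransform, cauchySeries]
  congr 1
  ext n
  rw [coeff_sndSeries, snd_coeff_momentExpansion, coeff_mk]

theorem cauchyTransform_eq (hκ : transSeries (-DualNumber.eps) κ = momentExpansion μ μ') :
    cauchyTransform μ = X * ncSeries fun j => (κ j).fst := by
  rw [cauchyTransform, cauchySeries, ← fstSeries_transSeries_neg_eps, hκ,
    fstSeries_momentExpansion]

theorem fst_eq_freeCumulant (h : HasInfinitesimalDistribution p μ μ')
    (hκ : transSeries (-DualNumber.eps) κ = momentExpansion μ μ') (n : ℕ) :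
    (κ (n + 1)).fst = freeCumulant μ (n + 1) := by
  have hμ : measMoment μ 0 = 1 := by
    rw [← fst_coeff_momentExpansion (μ' := μ'), coeff_zero_momentExpansion h,
      TrivSqZeroExt.fst_one]
  refine eq_of_ncSeries_eq (u := fun j => (κ j).fst) ?_ n
  rw [← mk_measMoment hμ, ← fstSeries_transSeries_neg_eps, hκ, fstSeries_momentExpansion]

theorem hTransform_eq (h : ∀ n, (κ (n + 1)).fst = freeCumulant μ (n + 1)) :
    hTransform μ = X * mk (annularCoeff fun j => (κ j).fst) := by
  rw [hTransform, cauchySeries]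
  congr 1
  ext n
  rw [coeff_mk, coeff_mk]
  split_ifs with hn
  · refine annularCoeff_congr (fun j hj => ?_) n
    obtain ⟨j, rfl⟩ := Nat.exists_eq_add_of_le' hj
    exact (h j).symm
  · exact (annularCoeff_of_lt_two _ (not_le.1 hn)).symm

theorem infCauchyTransform_add_hTransform (h : ∀ n, (κ (n + 1)).fst = freeCumulant μ (n + 1))
    (hκ : transSeries (-DualNumber.eps) κ = momentExpansion μ μ') :
    infCauchyTransform μ' + hTransform μ
      = -(PowerSeries.subst (cauchyTransform μ) (mk fun n => (κ (n + 1)).snd) : PowerSeries ℝ)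
        * derivZ (cauchyTransform μ) := by
  rw [← X_mul_sndSeries_momentExpansion, ← hκ, sndSeries_transSeries_neg_eps, hTransform_eq h,
    ← mul_add, sub_add_cancel, sndSeries_ncSeries, ← cauchyTransform_eq hκ, derivZ]
  ring

end InfinitesimalCauchyTransform

end FiniteFree

theorem mainTheorem5 (p : ℕ → Polynomial ℝ) (μ : MeasureTheory.Measure ℝ)
    (μ' : Polynomial ℝ →ₗ[ℝ] ℝ) (h : FiniteFree.HasInfinitesimalDistribution p μ μ') :
    (∀ n : ℕ, 1 ≤ n →
      (fun d : ℕ => FiniteFree.finiteFreeCumulant (p d) n - FiniteFree.freeCumulant μ n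
          - (1 / (d : ℝ)) * FiniteFree.cumulantFluctuation p μ n)
        =o[Filter.atTop] fun d : ℕ => 1 / (d : ℝ)) ∧
    FiniteFree.infCauchyTransform μ' =
      -(PowerSeries.subst (FiniteFree.cauchyTransform μ) (FiniteFree.fluctuationTransform p μ)
          : PowerSeries ℝ) * FiniteFree.derivZ (FiniteFree.cauchyTransform μ)
        - FiniteFree.hTransform μ := by
  open FiniteFree in
  obtain ⟨κ, hexp, hκ⟩ := exists_hasExpansion_finiteFreeCumulant h
  have hfst : ∀ n, (κ (n + 1)).fst = freeCumulant μ (n + 1) := fst_eq_freeCumulant h hκ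
  have hsnd (n : ℕ) : cumulantFluctuation p μ (n + 1) = (κ (n + 1)).snd := by
    rw [cumulantFluctuation, ← hfst n]
    exact (hexp n).2.limUnder_eq
  constructor
  · intro n hn
    obtain ⟨n, rfl⟩ := Nat.exists_eq_add_of_le' hn
    rw [← hfst n, hsnd n]
    exact (hexp n).isLittleO
  · have hR : fluctuationTransform p μ = PowerSeries.mk fun n => (κ (n + 1)).snd :=
      congrArg PowerSeries.mk (funext hsnd)
    rw [hR, ← infCauchyTransform_add_hTransform hfst hκ, add_sub_cancel_right]
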